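/- Let $\mathbb D=\{z\in\mathbb C:|z|<1\}$ and let $\mathcal A$ be the class of analytic functions $f:\mathbb D\to\mathbb C$ with $f(0)=0$, $f'(0)=1$. For analytic $f,g$ on $\mathbb D$ write $f\prec g$ if $f=g\circ w$ for some analytic $w:\mathbb D\to\mathbb D$ with $w(0)=0$. For $\varphi$ analytic on $\mathbb D$ with $\varphi(0)=1$ let $\mathcal S^*(\varphi)$ be the class of $f\in\mathcal A$ with $zf'(z)/f(z)\prec\varphi(z)$. With principal branches, put $\mathcal S^*(\alpha)=\mathcal S^*\big(\frac{1+(1-2\alpha)z}{1-z}\big)$, $\mathcal S^*_L=\mathcal S^*(\sqrt{1+z})$, $\mathcal S_p=\mathcal S^*\big(1+\frac{2}{\pi^2}\big(\log\frac{1+\sqrt z}{1-\sqrt z}\big)^2\big)$, $\mathcal S^*_e=\mathcal S^*(e^z)$, $\mathcal S^*_c=\mathcal S^*(1+\frac43z+\frac23z^2)$, $\mathcal S^*_{\sin}=\mathcal S^*(1+\sin z)$, $\mathcal S^*_{☾}=\mathcal S^*(z+\sqrt{1+z^2})$, $\mathcal S^*_R=\mathcal S^*\big(1+\frac{kz+z^2}{k^2-kz}\big)$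 with $k=\sqrt2+1$, $\mathcal S^*_{RL}=\mathcal S^*\Big(\sqrt2-(\sqrt2-1)\sqrt{\frac{1-z}{1+2(\sqrt2-1)z}}\Big)$, and $\mathcal S^*_\gamma=\mathcal S^*\big(\big(\frac{1+z}{1-z}\big)^\gamma\big)$ (strongly starlike functions of order $\gamma$). For $\mathcal G,\mathcal F\subseteq\mathcal A$ the $\mathcal G$-radius $R_{\mathcal G}$ of $\mathcal F$ is the largest $R\in(0,1]$ such that $z\mapsto r^{-1}f(rz)$ belongs to $\mathcal G$ for all $0<r\le R$ and all $f\in\mathcal F$. Let $\mathcal F_2$ be the class of $f\in\mathcal A$ such that $|f(z)/g(z)-1|<1$ $(z\in\mathbb D)$ for some $g\in\mathcal A$ with $\operatorname{Re}\big(\frac{1+z}{z}g(z)\big)>0$ $(z\in\mathbb D)$, the quotients being extended analytically to $z=0$. Theorem. For the class $\mathcal F_2$ all the following radii exist, and: (i) $R_{\mathcal S^*(\alpha)}=(1-\alpha)\big/\big(2+\sqrt{4+(\alpha-1)^2}\big)$ for $0\le\alpha<1$; (ii) $R_{\mathcal S^*_L}\ge(\sqrt5-2)/(1+\sqrt2)$;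 (iii) $R_{\mathcal S_p}=\sqrt{17}-4$; (iv) $R_{\mathcal S^*_e}=(2e-2)\big/\big(4e+\sqrt{20e^2-8e+4}\big)$; (v) $R_{\mathcal S^*_c}=\sqrt{10}-3$; (vi) $R_{\mathcal S^*_{\sin}}\ge\sin1\big/\big(2+\sqrt{4+\sin1\,(2+\sin1)}\big)$; (vii) $R_{\mathcal S^*_{☾}}=(2-\sqrt2)\big/\big(2+\sqrt{10-4\sqrt2}\big)$; (viii) $R_{\mathcal S^*_R}=(3-2\sqrt2)\big/\big(2+\sqrt{21-12\sqrt2}\big)$; (ix) the equation $$r^2(r+4)^2+(r^2-1)^2+(r^2-1)\sqrt{(r^2+\sqrt2)(2-\sqrt2-r^2)}-(1+\sqrt2(r^2-1))^2=0$$ has a smallest root $\rho$ among the $r\in[0,1]$ with $r^2\le2-\sqrt2$ (where the square root is real), $\rho\approx0.0692$ (that is, $|\rho-0.0692|<5\cdot10^{-5}$), and $R_{\mathcal S^*_{RL}}\ge\rho$; (x) $R_{\mathcal S^*_\gamma}\ge\sin(\pi\gamma/2)\big/\big(2+\sqrt{4+\sin(\pi\gamma/2)}\big)$ for $0<\gamma\le1$.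 The function $f_2(z)=z(1-z)^2/(1+z)^2$ belongs to $\mathcal F_2$ and is extremal in (i), (iii), (iv), (v), (vii) and (viii): if $\mathcal G$ is the class and $R$ the radius in question, then $z\mapsto r^{-1}f_2(rz)$ is not in $\mathcal G$ for any $R<r\le1$. -/

import Mathlib

noncomputable section

namespace RadiusStarlike

/-- The open unit disk. -/
def unitDisk : Set ℂ := Metric.ball 0 1

/-- The class `𝒜` of analytic functions on the unit disk with `f 0 = 0`, `f' 0 = 1`. Functions are
represented by total functions `ℂ → ℂ`; only their values on the disk matter. -/
def classA : Set (ℂ → ℂ) :=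
  {f | DifferentiableOn ℂ f unitDisk ∧ f 0 = 0 ∧ deriv f 0 = 1}

/-- Subordination `f ≺ g` on the unit disk. -/
def Subordinate (f g : ℂ → ℂ) : Prop :=
  ∃ w : ℂ → ℂ, DifferentiableOn ℂ w unitDisk ∧ Set.MapsTo w unitDisk unitDisk ∧ w 0 = 0 ∧
    ∀ z ∈ unitDisk, f z = g (w z)

/-- The function `z f'(z) / f(z)`, with its removable singularity at `0` filled in by the value `1`
(for `f` in the class `𝒜`). -/
def starQuotient (f : ℂ → ℂ) : ℂ → ℂ :=
  Function.update (fun z => z * deriv f z / f z) 0 1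

/-- The class `𝒮*(φ)` of all `f ∈ 𝒜` with `z f'(z) / f(z) ≺ φ(z)`; that the quotient is an analytic
function on the disk means that `f` has no zero other than `0` there. -/
def starClass (φ : ℂ → ℂ) : Set (ℂ → ℂ) :=
  {f | f ∈ classA ∧ (∀ z ∈ unitDisk, z ≠ 0 → f z ≠ 0) ∧ Subordinate (starQuotient f) φ}

/-- Starlike functions of order `α`. -/
def starOrder (α : ℝ) : Set (ℂ → ℂ) :=
  starClass fun z => (1 + (1 - 2 * (α : ℂ)) * z) / (1 - z)

/-- Starlike functions associated with the lemniscate of Bernoulli. -/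
def starBernoulli : Set (ℂ → ℂ) := starClass fun z => Complex.sqrt (1 + z)

/-- Parabolic starlike functions. -/
def starP : Set (ℂ → ℂ) :=
  starClass fun z => 1 + 2 / (Real.pi : ℂ) ^ 2 *
    Complex.log ((1 + Complex.sqrt z) / (1 - Complex.sqrt z)) ^ 2

/-- Starlike functions associated with the exponential function. -/
def starExp : Set (ℂ → ℂ) := starClass Complex.exp

/-- Starlike functions associated with a cardioid. -/
def starC : Set (ℂ → ℂ) := starClass fun z => 1 + 4 / 3 * z + 2 / 3 * z ^ 2

/-- Starlike functions associated with the sine function. -/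
def starSin : Set (ℂ → ℂ) := starClass fun z => 1 + Complex.sin z

/-- Starlike functions associated with a lune. -/
def starLune : Set (ℂ → ℂ) := starClass fun z => z + Complex.sqrt (1 + z ^ 2)

/-- The constant `k = √2 + 1`. -/
def kConst : ℂ := (√2 : ℝ) + 1

/-- Starlike functions associated with the rational function
`1 + (z k + z²) / (k² - k z)`, `k = √2 + 1`. -/
def starR : Set (ℂ → ℂ) :=
  starClass fun z => 1 + (z * kConst + z ^ 2) / (kConst ^ 2 - kConst * z)

/-- Starlike functions associated with the reverse (shifted) lemniscate. -/
def starRL : Set (ℂ → ℂ) :=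
  starClass fun z => ((√2 : ℝ) : ℂ) - (((√2 : ℝ) : ℂ) - 1) *
    Complex.sqrt ((1 - z) / (1 + 2 * (((√2 : ℝ) : ℂ) - 1) * z))

/-- Strongly starlike functions of order `γ`. -/
def starStrong (γ : ℝ) : Set (ℂ → ℂ) :=
  starClass fun z => ((1 + z) / (1 - z)) ^ (γ : ℂ)

/-- The dilation `z ↦ r⁻¹ f (r z)`. -/
def dilate (r : ℝ) (f : ℂ → ℂ) : ℂ → ℂ := fun z => (r : ℂ)⁻¹ * f (r * z)

/-- All `R ∈ (0, 1]` such that `r⁻¹ f (r z)` belongs to `G` for all `0 < r ≤ R` and `f ∈ F`. -/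
def radiusSet (G F : Set (ℂ → ℂ)) : Set ℝ :=
  {R | 0 < R ∧ R ≤ 1 ∧ ∀ r : ℝ, 0 < r → r ≤ R → ∀ f ∈ F, dilate r f ∈ G}

/-- `R` is the `G`-radius of the family `F`: the largest `R` with the property above. -/
def IsRadius (G F : Set (ℂ → ℂ)) (R : ℝ) : Prop := IsGreatest (radiusSet G F) R

/-- The class `𝓕₂`. The two quotients have removable singularities at `0`, where both take the
value `1`, so that the two inequalities hold automatically at that point. -/
def classF2 : Set (ℂ → ℂ) :=
  {f | f ∈ classA ∧ ∃ g ∈ classA,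
    (∀ z ∈ unitDisk, z ≠ 0 → 0 < ((1 + z) / z * g z).re) ∧
    ∀ z ∈ unitDisk, z ≠ 0 → ‖f z / g z - 1‖ < 1}

/-- The function `z (1 - z)² / (1 + z)²`. -/
def extremalF2 : ℂ → ℂ := fun z => z * (1 - z) ^ 2 / (1 + z) ^ 2

/-- `R` is the `G`-radius of `𝓕₂` and `extremalF2` is extremal for it: none of its dilations with
factor larger than `R` is in `G`. -/
def IsSharpRadiusF2 (G : Set (ℂ → ℂ)) (R : ℝ) : Prop :=
  IsRadius G classF2 R ∧ ∀ r : ℝ, R < r → r ≤ 1 → dilate r extremalF2 ∉ G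

/-- The `G`-radius of `𝓕₂` exists and is at least `c`. -/
def RadiusF2AtLeast (G : Set (ℂ → ℂ)) (c : ℝ) : Prop :=
  ∃ R : ℝ, IsRadius G classF2 R ∧ c ≤ R

/-- Left-hand side of the equation for the reverse lemniscate; the radicand is nonnegative
exactly when `r² ≤ 2 - √2`. -/
def lhsRL (r : ℝ) : ℝ :=
  r ^ 2 * (r + 4) ^ 2 + (r ^ 2 - 1) ^ 2 + (r ^ 2 - 1) * √((r ^ 2 + √2) * (2 - √2 - r ^ 2))
    - (1 + √2 * (r ^ 2 - 1)) ^ 2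

end RadiusStarlike

end

open RadiusStarlike

namespace RadiusStarlike

open Complex Filter Topology ComplexConjugate

/-! For `f` in `classF2` with companion `g`, write `f = zF`, `g = zG`, `p = (1+z)G`, `q = F/G`. Then
`F = qp/(1+z)`, so `zf'/f = 1/(1+z) + zp'/p + zq'/q`, where `Re p > 0`, `|q-1| < 1` and `q(0) = 1`.
With `r = |z|`, Schwarz–Pick bounds the last two terms by `2r/(1-r²)` and `r/(1-r)`, and `1/(1+z)`
lies in the disk with centre `1/(1-r²)` and radius `r/(1-r²)`. Hence `zf'/f` lies in the disk with
centre `1/(1-r²)` and radius `(r²+4r)/(1-r²)` (`norm_starQuotient_sub_le`). These disks grow with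
`r`; their left endpoint `1-4r/(1-r²)` is the value of `zf'/f` for `extremalF2` at `z = r`.

So `R` is admissible for `𝒮*(φ)` once the disk belonging to `R` lies in a set on which `φ` has a
holomorphic right inverse `ψ` into the unit disk with `ψ(1) = 0`: the subordinating function is `ψ ∘
(zf'/f)` (`mem_radiusSet_of_rightInverse`). In the sharp cases the left endpoint meets the boundary
of `φ(𝔻)` at a real point `y`, and `φ` omits the real numbers just below `y`, which excludes the
extremal function beyond `R` (`isSharpRadiusF2_of_rightInverse`). In the other cases only an
admissible `R` is exhibited. A largest one exists because for univalent `φ` the subordinating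
functions for smaller dilations glue together (`radiusF2AtLeast_of_mem`). What remains for each
class is an explicit `ψ` and the proof that a suitable disk lies in the image of `φ`. -/

/-! ### Norm comparisons and automorphisms of the unit disk. -/

lemma mem_unitDisk {z : ℂ} : z ∈ unitDisk ↔ ‖z‖ < 1 := by
  simp [unitDisk]

lemma isOpen_unitDisk : IsOpen unitDisk := Metric.isOpen_ball

lemma zero_mem_unitDisk : (0 : ℂ) ∈ unitDisk := by simp [unitDisk]

lemma unitDisk_mem_nhds {z : ℂ} (hz : z ∈ unitDisk) : unitDisk ∈ 𝓝 z :=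
  isOpen_unitDisk.mem_nhds hz

lemma normSq_eq_re_im (z : ℂ) : ‖z‖ ^ 2 = z.re ^ 2 + z.im ^ 2 := by
  rw [Complex.sq_norm, Complex.normSq_apply]; ring

lemma norm_lt_norm_iff {z w : ℂ} :
    ‖z‖ < ‖w‖ ↔ z.re ^ 2 + z.im ^ 2 < w.re ^ 2 + w.im ^ 2 := by
  rw [← normSq_eq_re_im, ← normSq_eq_re_im, sq_lt_sq₀ (norm_nonneg _) (norm_nonneg _)]

lemma norm_lt_iff {z : ℂ} {c : ℝ} (hc : 0 ≤ c) :
    ‖z‖ < c ↔ z.re ^ 2 + z.im ^ 2 < c ^ 2 := by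
  rw [← normSq_eq_re_im, sq_lt_sq₀ (norm_nonneg _) hc]

lemma norm_div_lt_one {z w : ℂ} (h : ‖z‖ < ‖w‖) : ‖z / w‖ < 1 := by
  rw [norm_div, div_lt_one ((norm_nonneg _).trans_lt h)]; exact h

lemma ne_zero_of_norm_lt {z w : ℂ} (h : ‖z‖ < ‖w‖) : w ≠ 0 :=
  norm_pos_iff.1 ((norm_nonneg _).trans_lt h)

/-- The disk automorphism `u ↦ (u + a) / (1 + conj a * u)`. -/
noncomputable def diskShift (a u : ℂ) : ℂ := (u + a) / (1 + conj a * u)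

/-- This is the identity `|1 + āu|² - |u + a|² = (1 - |a|²)(1 - |u|²)`. -/
lemma norm_lt_norm_diskShift {a u : ℂ} (ha : ‖a‖ < 1) (hu : ‖u‖ < 1) :
    ‖u + a‖ < ‖1 + conj a * u‖ := by
  rw [norm_lt_norm_iff]
  rw [norm_lt_iff zero_le_one] at ha hu
  simp only [add_re, add_im, one_re, one_im, mul_re, mul_im, conj_re, conj_im]
  nlinarith [mul_pos (sub_pos.2 ha) (sub_pos.2 hu)]

lemma diskShift_mem {a u : ℂ} (ha : ‖a‖ < 1) (hu : ‖u‖ < 1) : ‖diskShift a u‖ < 1 :=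
  norm_div_lt_one (norm_lt_norm_diskShift ha hu)

lemma hasDerivAt_diskShift {a u : ℂ} (h : 1 + conj a * u ≠ 0) :
    HasDerivAt (diskShift a) ((1 - ‖a‖ ^ 2) / (1 + conj a * u) ^ 2) u := by
  have h1 : HasDerivAt (fun u : ℂ => u + a) 1 u := (hasDerivAt_id u).add_const a
  have h2 : HasDerivAt (fun u : ℂ => 1 + conj a * u) (conj a) u := by
    simpa using ((hasDerivAt_id u).const_mul (conj a)).const_add 1
  refine (h1.div h2 h).congr_deriv ?_
  congr 1
  rw [← Complex.mul_conj']; ring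

/-! ### Schwarz–Pick and bounds for logarithmic derivatives. -/

/-- The **Schwarz–Pick lemma**, derivative form. -/
theorem norm_deriv_mul_le_of_mapsTo_unitDisk {w : ℂ → ℂ} (hd : DifferentiableOn ℂ w unitDisk)
    (hw : Set.MapsTo w unitDisk unitDisk) {z : ℂ} (hz : z ∈ unitDisk) :
    ‖deriv w z‖ * (1 - ‖z‖ ^ 2) ≤ 1 - ‖w z‖ ^ 2 := by
  have hz1 := mem_unitDisk.1 hz
  have hb : ‖w z‖ < 1 := mem_unitDisk.1 (hw hz)
  have hb' : ‖-w z‖ < 1 := by simpa using hb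
  -- Automorphisms moving `0` to `z` and `w z` to `0` turn `w` into a map fixing `0`, for which the
  -- Schwarz lemma gives `|F'(0)| ≤ 1`.
  set F : ℂ → ℂ := fun u => diskShift (-w z) (w (diskShift z u)) with hF
  have hder : ∀ u ∈ unitDisk, HasDerivAt F ((1 - ‖-w z‖ ^ 2) /
      (1 + conj (-w z) * w (diskShift z u)) ^ 2 * (deriv w (diskShift z u) *
        ((1 - ‖z‖ ^ 2) / (1 + conj z * u) ^ 2))) u := by
    intro u hu
    have hu1 := mem_unitDisk.1 hu
    have hm : diskShift z u ∈ unitDisk := mem_unitDisk.2 (diskShift_mem hz1 hu1)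
    have e1 := hasDerivAt_diskShift (ne_zero_of_norm_lt (norm_lt_norm_diskShift hz1 hu1))
    have e2 := (hd.differentiableAt (unitDisk_mem_nhds hm)).hasDerivAt
    have e3 := hasDerivAt_diskShift (ne_zero_of_norm_lt
      (norm_lt_norm_diskShift hb' (mem_unitDisk.1 (hw hm))))
    exact e3.comp u (e2.comp u e1)
  have h0 : diskShift z 0 = z := by simp [diskShift]
  have hF0 : F 0 = 0 := by simp [hF, diskShift]
  have hle := Complex.norm_deriv_le_one_of_mapsTo_ball (f := F) (c := 0) (R := 1)
    (fun u hu => (hder u hu).differentiableAt.differentiableWithinAt)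
    (by
      intro u hu
      rw [hF0]
      have hm : diskShift z u ∈ unitDisk :=
        mem_unitDisk.2 (diskShift_mem hz1 (mem_unitDisk.1 hu))
      simpa using (diskShift_mem hb' (mem_unitDisk.1 (hw hm))).le) one_pos
  rw [(hder 0 zero_mem_unitDisk).deriv, h0] at hle
  have hpos : 0 < 1 - ‖w z‖ ^ 2 := by nlinarith [norm_nonneg (w z)]
  have hpos2 : 0 < 1 - ‖z‖ ^ 2 := by nlinarith [norm_nonneg z]
  have hden : (1 : ℂ) + conj (-w z) * w z = ((1 - ‖w z‖ ^ 2 : ℝ) : ℂ) := by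
    rw [map_neg, neg_mul, Complex.conj_mul']; push_cast; ring
  have hnum : ((1 : ℂ) - (‖-w z‖ : ℂ) ^ 2) = ((1 - ‖w z‖ ^ 2 : ℝ) : ℂ) := by
    rw [norm_neg]; push_cast; ring
  have hnum2 : ((1 : ℂ) - (‖z‖ : ℂ) ^ 2) = ((1 - ‖z‖ ^ 2 : ℝ) : ℂ) := by push_cast; ring
  rw [hden, hnum, hnum2] at hle
  simp only [mul_zero, add_zero, one_pow, div_one, norm_mul, norm_div, norm_pow, norm_real,
    Real.norm_eq_abs, abs_of_pos hpos, abs_of_pos hpos2] at hle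
  rw [sq (1 - ‖w z‖ ^ 2), div_mul_eq_div_div, div_self hpos.ne', one_div,
    inv_mul_le_iff₀ hpos, mul_one] at hle
  exact hle

lemma norm_sub_one_lt_norm_add_one {p : ℂ} (hp : 0 < p.re) : ‖p - 1‖ < ‖p + 1‖ := by
  rw [norm_lt_norm_iff]
  simp only [sub_re, sub_im, add_re, add_im, one_re, one_im]
  nlinarith

/-- A function with positive real part has `|z p'(z) / p(z)| ≤ 2 |z| / (1 - |z|²)`. -/
theorem norm_logDeriv_le_of_re_pos {p : ℂ → ℂ} (hd : DifferentiableOn ℂ p unitDisk)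
    (hp : ∀ z ∈ unitDisk, 0 < (p z).re) {z : ℂ} (hz : z ∈ unitDisk) :
    ‖z * deriv p z / p z‖ ≤ 2 * ‖z‖ / (1 - ‖z‖ ^ 2) := by
  have hz1 := mem_unitDisk.1 hz
  have hlt : ∀ u ∈ unitDisk, ‖p u - 1‖ < ‖p u + 1‖ := fun u hu =>
    norm_sub_one_lt_norm_add_one (hp u hu)
  have hder : ∀ u ∈ unitDisk, HasDerivAt (fun u => (p u - 1) / (p u + 1))
      ((deriv p u * (p u + 1) - (p u - 1) * deriv p u) / (p u + 1) ^ 2) u := by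
    intro u hu
    have e := (hd.differentiableAt (unitDisk_mem_nhds hu)).hasDerivAt
    exact (e.sub_const 1).div (e.add_const 1) (ne_zero_of_norm_lt (hlt u hu))
  -- Cayley transform `w = (p-1)/(p+1)`: here `w' = 2p'/(p+1)²` and `1 - |w|² = 4 Re p / |p+1|²`, so
  -- Schwarz–Pick reads `|p'|(1-|z|²) ≤ 2 Re p ≤ 2|p|`.
  have key := norm_deriv_mul_le_of_mapsTo_unitDisk (w := fun u => (p u - 1) / (p u + 1))
    (fun u hu => (hder u hu).differentiableAt.differentiableWithinAt)
    (fun u hu => mem_unitDisk.2 (norm_div_lt_one (hlt u hu))) hz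
  rw [(hder z hz).deriv] at key
  have hn : 0 < ‖p z + 1‖ := (norm_nonneg _).trans_lt (hlt z hz)
  have e1 : deriv p z * (p z + 1) - (p z - 1) * deriv p z = 2 * deriv p z := by ring
  have hpos2 : 0 < 1 - ‖z‖ ^ 2 := by nlinarith [norm_nonneg z]
  rw [e1, norm_div, norm_div, norm_mul, norm_pow, Complex.norm_two, div_pow,
    one_sub_div (pow_pos hn 2).ne', div_mul_eq_mul_div, div_le_div_iff_of_pos_right (pow_pos hn 2),
    normSq_eq_re_im (p z + 1), normSq_eq_re_im (p z - 1)] at key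
  simp only [sub_re, sub_im, add_re, add_im, one_re, one_im] at key
  have hre : (p z).re ≤ ‖p z‖ := Complex.re_le_norm _
  have hpz : 0 < ‖p z‖ := (hp z hz).trans_le hre
  rw [norm_div, norm_mul, div_le_div_iff₀ hpz hpos2]
  nlinarith [norm_nonneg z, mul_le_mul_of_nonneg_left
    (show ‖deriv p z‖ * (1 - ‖z‖ ^ 2) ≤ 2 * ‖p z‖ by linarith) (norm_nonneg z)]

/-- If `|q - 1| < 1` and `q 0 = 1`, then `|z q'(z) / q(z)| ≤ |z| / (1 - |z|)`. -/
theorem norm_logDeriv_le_of_norm_sub_one_lt {q : ℂ → ℂ} (hd : DifferentiableOn ℂ q unitDisk)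
    (hq : ∀ z ∈ unitDisk, ‖q z - 1‖ < 1) (hq0 : q 0 = 1) {z : ℂ} (hz : z ∈ unitDisk) :
    ‖z * deriv q z / q z‖ ≤ ‖z‖ / (1 - ‖z‖) := by
  have hz1 := mem_unitDisk.1 hz
  have hmap : Set.MapsTo (fun u => q u - 1) unitDisk unitDisk := fun u hu =>
    mem_unitDisk.2 (hq u hu)
  have key := norm_deriv_mul_le_of_mapsTo_unitDisk (hd.sub_const 1) hmap hz
  have hle : ‖q z - 1‖ ≤ ‖z‖ := Complex.norm_le_norm_of_mapsTo_ball (f := fun u => q u - 1)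
    (R := 1) (hd.sub_const 1) (hmap.mono_right Metric.ball_subset_closedBall) (by simp [hq0]) hz1
  rw [deriv_sub_const] at key
  have hlow : 1 - ‖q z - 1‖ ≤ ‖q z‖ := by
    have := norm_sub_norm_le (1 : ℂ) (1 - q z)
    rw [norm_sub_rev 1 (q z), norm_one] at this
    simpa using this
  have hqpos : 0 < ‖q z‖ := by linarith [hq z hz]
  have h1 : ‖deriv q z‖ * (1 - ‖z‖) ≤ ‖q z‖ := by
    have hz0 := norm_nonneg z
    have hw0 := norm_nonneg (q z - 1)
    -- With `s = |q-1|`, Schwarz–Pick bounds the left side by `(1-s)(1+s)`; here `1-s ≤ |q|`, and `s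
    -- ≤ |z|` by the Schwarz lemma.
    have : ‖deriv q z‖ * (1 - ‖z‖) * (1 + ‖z‖) ≤ ‖q z‖ * (1 + ‖z‖) := by
      nlinarith [mul_nonneg (hqpos.le) (sub_nonneg.2 hle),
        mul_nonneg (sub_nonneg.2 hlow) (by linarith : 0 ≤ 1 + ‖q z - 1‖)]
    exact le_of_mul_le_mul_right this (by linarith)
  rw [norm_div, norm_mul, div_le_div_iff₀ hqpos (by linarith)]
  nlinarith [mul_le_mul_of_nonneg_left h1 (norm_nonneg z)]

/-- The point `1 / (1 + z)` lies in the disk with diameter `[1 / (1 + |z|), 1 / (1 - |z|)]`. -/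
lemma norm_inv_one_add_sub_le {z : ℂ} (hz : ‖z‖ < 1) :
    ‖1 / (1 + z) - 1 / (1 - (‖z‖ : ℂ) ^ 2)‖ ≤ ‖z‖ / (1 - ‖z‖ ^ 2) := by
  have hpos2 : 0 < 1 - ‖z‖ ^ 2 := by nlinarith [norm_nonneg z]
  have hne : (1 : ℂ) + z ≠ 0 := by
    intro h
    have : z = -1 := by linear_combination h
    rw [this] at hz; simp at hz
  have hc : (1 : ℂ) - (‖z‖ : ℂ) ^ 2 = ((1 - ‖z‖ ^ 2 : ℝ) : ℂ) := by push_cast; ring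
  have hne2 : (1 : ℂ) - (‖z‖ : ℂ) ^ 2 ≠ 0 := by rw [hc]; exact_mod_cast hpos2.ne'
  have e : 1 / (1 + z) - 1 / (1 - (‖z‖ : ℂ) ^ 2) =
      -(z * (1 + conj z)) / ((1 + z) * (1 - (‖z‖ : ℂ) ^ 2)) := by
    rw [div_sub_div _ _ hne hne2]
    congr 1
    rw [← Complex.mul_conj']; ring
  have e2 : ‖1 + conj z‖ = ‖1 + z‖ := by
    rw [← Complex.norm_conj (1 + z)]; simp
  rw [e, norm_div, norm_neg, norm_mul, norm_mul, e2, hc, norm_real, Real.norm_eq_abs,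
    abs_of_pos hpos2, mul_comm ‖z‖, mul_div_mul_left _ _ (norm_pos_iff.2 hne).ne']

/-! ### The disk containing the values of `zf'/f` on the class. -/

/-- For `f = z F` in the class `𝒜`, `z f' / f = 1 + z F' / F`. -/
lemma starQuotient_eq {f : ℂ → ℂ} (hf : f ∈ classA) {z : ℂ} (hz : z ∈ unitDisk)
    (hne : z ≠ 0 → f z ≠ 0) :
    starQuotient f z = 1 + z * deriv (dslope f 0) z / dslope f 0 z := by
  rcases eq_or_ne z 0 with rfl | h0
  · simp [starQuotient]
  have hfd : DifferentiableOn ℂ (dslope f 0) unitDisk :=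
    (differentiableOn_dslope (unitDisk_mem_nhds zero_mem_unitDisk)).2 hf.1
  have hfe : f = fun u => u * dslope f 0 u := by
    funext u
    have := sub_smul_dslope f 0 u
    simp only [sub_zero, smul_eq_mul, hf.2.1] at this
    exact this.symm
  have hd : deriv f z = dslope f 0 z + z * deriv (dslope f 0) z := by
    conv_lhs => rw [hfe]
    exact (((hasDerivAt_id' z).mul
      (hfd.differentiableAt (unitDisk_mem_nhds hz)).hasDerivAt).congr_deriv (by simp)).deriv
  have hz1 : f z = z * dslope f 0 z := congrFun hfe z
  have hFne : dslope f 0 z ≠ 0 := fun h => hne h0 (by rw [hz1, h, mul_zero])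
  rw [starQuotient, Function.update_of_ne h0, hd, hz1]
  field_simp

lemma classF2_ne_zero {f : ℂ → ℂ} (hf : f ∈ classF2) {z : ℂ} (hz : z ∈ unitDisk) (h0 : z ≠ 0) :
    f z ≠ 0 := by
  obtain ⟨-, g, -, -, h⟩ := hf
  intro hfz
  have := h z hz h0
  simp [hfz] at this

lemma dslope_eq_div {f : ℂ → ℂ} (hf : f ∈ classA) {z : ℂ} (h0 : z ≠ 0) :
    dslope f 0 z = f z / z := by
  rw [dslope_of_ne _ h0, slope_def_field, hf.2.1, sub_zero, sub_zero]

/-- The values of `z f'(z) / f(z)` for `f` in the class `𝓕₂`. -/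
theorem norm_starQuotient_sub_le {f : ℂ → ℂ} (hf : f ∈ classF2) {z : ℂ} (hz : z ∈ unitDisk) :
    ‖starQuotient f z - 1 / (1 - (‖z‖ : ℂ) ^ 2)‖ ≤ (‖z‖ ^ 2 + 4 * ‖z‖) / (1 - ‖z‖ ^ 2) := by
  have hfne := classF2_ne_zero hf hz
  obtain ⟨hfA, g, hgA, hg, hfg⟩ := hf
  rw [starQuotient_eq hfA hz hfne]
  have h0 := unitDisk_mem_nhds zero_mem_unitDisk
  have hFd : DifferentiableOn ℂ (dslope f 0) unitDisk := (differentiableOn_dslope h0).2 hfA.1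
  have hGd : DifferentiableOn ℂ (dslope g 0) unitDisk := (differentiableOn_dslope h0).2 hgA.1
  set F := dslope f 0
  set G := dslope g 0
  have hF0 : F 0 = 1 := by simp only [F, dslope_same, hfA.2.2]
  have hG0 : G 0 = 1 := by simp only [G, dslope_same, hgA.2.2]
  have hpre : ∀ u ∈ unitDisk, 0 < ((1 + u) * G u).re := by
    intro u hu
    rcases eq_or_ne u 0 with rfl | hu0
    · simp [hG0]
    · have := hg u hu hu0
      rw [show (1 + u) * G u = (1 + u) / u * g u by
        simp only [G]; rw [dslope_eq_div hgA hu0]; ring]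
      exact this
  have hGne : ∀ u ∈ unitDisk, G u ≠ 0 := by
    intro u hu h
    have := hpre u hu
    simp [h] at this
  have hq : ∀ u ∈ unitDisk, ‖F u / G u - 1‖ < 1 := by
    intro u hu
    rcases eq_or_ne u 0 with rfl | hu0
    · simp [hF0, hG0]
    · have := hfg u hu hu0
      rwa [show F u / G u = f u / g u by
        simp only [F, G]; rw [dslope_eq_div hfA hu0, dslope_eq_div hgA hu0]; field_simp]
  have hpd : DifferentiableOn ℂ (fun u => (1 + u) * G u) unitDisk := by fun_prop
  have hqd : DifferentiableOn ℂ (fun u => F u / G u) unitDisk := hFd.div hGd hGne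
  have b1 := norm_logDeriv_le_of_re_pos hpd hpre hz
  have b2 := norm_logDeriv_le_of_norm_sub_one_lt hqd hq (by simp [hF0, hG0]) hz
  have hz1 := mem_unitDisk.1 hz
  have b3 := norm_inv_one_add_sub_le hz1
  have hFe := (hFd.differentiableAt (unitDisk_mem_nhds hz)).hasDerivAt
  have hGe := (hGd.differentiableAt (unitDisk_mem_nhds hz)).hasDerivAt
  have hG1 := hGne z hz
  have hF1 : F z ≠ 0 := by
    intro h
    have := hq z hz
    simp [h] at this
  have hz2 : (1 : ℂ) + z ≠ 0 := by
    intro h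
    have := hpre z hz
    simp [h] at this
  have d1 : deriv (fun u => (1 + u) * G u) z = G z + (1 + z) * deriv G z :=
    ((((hasDerivAt_id' z).const_add 1).mul hGe).congr_deriv (by simp)).deriv
  have d2 : deriv (fun u => F u / G u) z = (deriv F z * G z - F z * deriv G z) / G z ^ 2 :=
    (hFe.div hGe hG1).deriv
  rw [d1] at b1
  rw [d2] at b2
  -- Logarithmic differentiation of `F = qp/(1+z)`, using `1 - z/(1+z) = 1/(1+z)`.
  have e : 1 + z * deriv F z / F z - 1 / (1 - (‖z‖ : ℂ) ^ 2) =
      (1 / (1 + z) - 1 / (1 - (‖z‖ : ℂ) ^ 2)) +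
      z * (G z + (1 + z) * deriv G z) / ((1 + z) * G z) +
      z * ((deriv F z * G z - F z * deriv G z) / G z ^ 2) / (F z / G z) := by
    have : 1 + z * deriv F z / F z = 1 / (1 + z) +
      z * (G z + (1 + z) * deriv G z) / ((1 + z) * G z) +
      z * ((deriv F z * G z - F z * deriv G z) / G z ^ 2) / (F z / G z) := by
      field_simp
      ring
    rw [this]; ring
  rw [e]
  refine (norm_add₃_le).trans ((add_le_add (add_le_add b3 b1) b2).trans_eq ?_)
  have h1 : 1 - ‖z‖ ≠ 0 := by linarith
  have h2 : 1 - ‖z‖ ^ 2 ≠ 0 := by nlinarith [norm_nonneg z]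
  have h3 : 1 - ‖z‖ ^ 2 = (1 - ‖z‖) * (1 + ‖z‖) := by ring
  have h4 : 1 + ‖z‖ ≠ 0 := by linarith [norm_nonneg z]
  rw [h3]
  field_simp
  ring

/-! ### Dilations, nested disks and admissible radii. -/

lemma mul_mem_unitDisk {r : ℝ} (hr0 : 0 < r) (hr1 : r ≤ 1) {z : ℂ} (hz : z ∈ unitDisk) :
    (r : ℂ) * z ∈ unitDisk := by
  rw [mem_unitDisk] at *
  rw [norm_mul, norm_real, Real.norm_eq_abs, abs_of_pos hr0]
  nlinarith [norm_nonneg z]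

lemma deriv_dilate {r : ℝ} (hr : r ≠ 0) (f : ℂ → ℂ) (z : ℂ) :
    deriv (dilate r f) z = deriv f (r * z) := by
  have hr' : (r : ℂ) ≠ 0 := by exact_mod_cast hr
  unfold dilate
  rw [deriv_const_mul_field, deriv_comp_mul_left, smul_eq_mul, ← mul_assoc, inv_mul_cancel₀ hr',
    one_mul]

lemma dilate_mem_classA {r : ℝ} (hr0 : 0 < r) (hr1 : r ≤ 1) {f : ℂ → ℂ} (hf : f ∈ classA) :
    dilate r f ∈ classA := by
  refine ⟨?_, by simp [dilate, hf.2.1], by rw [deriv_dilate hr0.ne', mul_zero, hf.2.2]⟩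
  have : DifferentiableOn ℂ (fun z => f (r * z)) unitDisk :=
    hf.1.comp (by fun_prop) fun z hz => mul_mem_unitDisk hr0 hr1 hz
  exact this.const_mul _

lemma starQuotient_dilate {r : ℝ} (hr : r ≠ 0) (f : ℂ → ℂ) (z : ℂ) :
    starQuotient (dilate r f) z = starQuotient f (r * z) := by
  have hr' : (r : ℂ) ≠ 0 := by exact_mod_cast hr
  rcases eq_or_ne z 0 with rfl | h0
  · simp [starQuotient]
  rw [starQuotient, starQuotient, Function.update_of_ne h0,
    Function.update_of_ne (mul_ne_zero hr' h0), deriv_dilate hr, dilate]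
  rw [div_mul_eq_div_div_swap, div_inv_eq_mul]
  ring

lemma starQuotient_zero (f : ℂ → ℂ) : starQuotient f 0 = 1 := by simp [starQuotient]

lemma differentiableOn_starQuotient {f : ℂ → ℂ} (hf : f ∈ classA)
    (hne : ∀ z ∈ unitDisk, z ≠ 0 → f z ≠ 0) : DifferentiableOn ℂ (starQuotient f) unitDisk := by
  have hFd : DifferentiableOn ℂ (dslope f 0) unitDisk :=
    (differentiableOn_dslope (unitDisk_mem_nhds zero_mem_unitDisk)).2 hf.1
  have hF : ∀ z ∈ unitDisk, dslope f 0 z ≠ 0 := by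
    intro z hz
    rcases eq_or_ne z 0 with rfl | h0
    · simp [dslope_same, hf.2.2]
    · rw [dslope_eq_div hf h0]
      exact div_ne_zero (hne z hz h0) h0
  have : DifferentiableOn ℂ (fun z => 1 + z * deriv (dslope f 0) z / dslope f 0 z) unitDisk :=
    ((differentiableOn_id.mul (hFd.deriv isOpen_unitDisk)).div hFd hF).const_add 1
  exact this.congr fun z hz => starQuotient_eq hf hz (hne z hz)

/-- The centre of the disk containing the values of `z f'(z) / f(z)` on `|z| < R`. -/
noncomputable def centerF2 (R : ℝ) : ℝ := 1 / (1 - R ^ 2)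

/-- The radius of the disk containing the values of `z f'(z) / f(z)` on `|z| < R`. -/
noncomputable def spreadF2 (R : ℝ) : ℝ := (R ^ 2 + 4 * R) / (1 - R ^ 2)

/-- The left endpoint `1 - 4R / (1 - R²)` of that disk. -/
noncomputable def leftF2 (R : ℝ) : ℝ := 1 - 4 * R / (1 - R ^ 2)

lemma one_sub_sq_pos {R : ℝ} (hR0 : 0 ≤ R) (hR1 : R < 1) : 0 < 1 - R ^ 2 := by nlinarith

lemma centerF2_sub_spreadF2 {R : ℝ} (hR0 : 0 ≤ R) (hR1 : R < 1) :
    centerF2 R - spreadF2 R = leftF2 R := by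
  have := (one_sub_sq_pos hR0 hR1).ne'
  unfold centerF2 spreadF2 leftF2
  field_simp
  ring

lemma leftF2_strictAnti {s t : ℝ} (hs : 0 ≤ s) (hst : s < t) (ht : t < 1) :
    leftF2 t < leftF2 s := by
  have h1 := one_sub_sq_pos hs (hst.trans ht)
  have h2 := one_sub_sq_pos (hs.trans hst.le) ht
  unfold leftF2
  rw [sub_lt_sub_iff_left, div_lt_div_iff₀ h1 h2]
  nlinarith [mul_nonneg hs (hs.trans hst.le)]

lemma centerF2_mono {s t : ℝ} (hs : 0 ≤ s) (hst : s ≤ t) (ht : t < 1) :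
    centerF2 s ≤ centerF2 t := by
  have h2 := one_sub_sq_pos (hs.trans hst) ht
  unfold centerF2
  exact one_div_le_one_div_of_le h2 (by nlinarith)

/-- The disk for `|z|` lies in the open disk for `R`: the centre moves right while the left endpoint
moves strictly left, so the radius grows by more than the centre moves. -/
lemma starQuotient_mem_ball {f : ℂ → ℂ} (hf : f ∈ classF2) {R : ℝ} (hR1 : R < 1) {z : ℂ}
    (hz : ‖z‖ < R) : starQuotient f z ∈ Metric.ball (centerF2 R : ℂ) (spreadF2 R) := by
  have hz1 : ‖z‖ < 1 := hz.trans hR1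
  have hz0 := norm_nonneg z
  have h := norm_starQuotient_sub_le hf (mem_unitDisk.2 hz1)
  have e : (1 : ℂ) / (1 - (‖z‖ : ℂ) ^ 2) = (centerF2 ‖z‖ : ℂ) := by
    unfold centerF2; push_cast; ring
  rw [e] at h
  change _ ≤ spreadF2 ‖z‖ at h
  rw [Metric.mem_ball, dist_eq_norm]
  have e2 : starQuotient f z - (centerF2 R : ℂ) =
      (starQuotient f z - (centerF2 ‖z‖ : ℂ)) + ((centerF2 ‖z‖ - centerF2 R : ℝ) : ℂ) := by
    push_cast; ring
  have hm := centerF2_mono hz0 hz.le hR1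
  have hl := leftF2_strictAnti hz0 hz hR1
  rw [← centerF2_sub_spreadF2 hz0 hz1, ← centerF2_sub_spreadF2 (hz0.trans hz.le) hR1] at hl
  rw [e2]
  refine (norm_add_le _ _).trans_lt ?_
  rw [norm_real, Real.norm_eq_abs, abs_of_nonpos (by linarith)]
  linarith

/-- If `φ` has a holomorphic right inverse with values in the unit disk on a set containing the
values of `z f'(z) / f(z)` on `|z| < R`, then `R` is admissible for `𝒮*(φ)`. -/
theorem mem_radiusSet_of_rightInverse {φ ψ : ℂ → ℂ} {R : ℝ} {U : Set ℂ} (hR0 : 0 < R)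
    (hR1 : R < 1) (hU : Metric.ball (centerF2 R : ℂ) (spreadF2 R) ⊆ U)
    (hψ : DifferentiableOn ℂ ψ U) (hmap : Set.MapsTo ψ U unitDisk) (hψ1 : ψ 1 = 0)
    (hφ : ∀ u ∈ U, φ (ψ u) = u) : R ∈ radiusSet (starClass φ) classF2 := by
  refine ⟨hR0, hR1.le, fun r hr0 hrR f hf => ?_⟩
  have hr1 : r ≤ 1 := hrR.trans hR1.le
  have hr' : (r : ℂ) ≠ 0 := by exact_mod_cast hr0.ne'
  have hmem : ∀ z ∈ unitDisk, starQuotient f (r * z) ∈ U := by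
    intro z hz
    refine hU (starQuotient_mem_ball hf hR1 ?_)
    rw [norm_mul, norm_real, Real.norm_eq_abs, abs_of_pos hr0]
    have := mem_unitDisk.1 hz
    nlinarith [norm_nonneg z]
  have hd := differentiableOn_starQuotient hf.1 fun z hz h0 => classF2_ne_zero hf hz h0
  refine ⟨dilate_mem_classA hr0 hr1 hf.1, fun z hz h0 => ?_,
    fun z => ψ (starQuotient f (r * z)), ?_, ?_, ?_, ?_⟩
  · exact mul_ne_zero (inv_ne_zero hr')
      (classF2_ne_zero hf (mul_mem_unitDisk hr0 hr1 hz) (mul_ne_zero hr' h0))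
  · have h1 : DifferentiableOn ℂ (fun z => starQuotient f (r * z)) unitDisk :=
      hd.comp (by fun_prop) fun z hz => mul_mem_unitDisk hr0 hr1 hz
    exact hψ.comp h1 hmem
  · exact fun z hz => hmap (hmem z hz)
  · simp only [mul_zero, starQuotient_zero, hψ1]
  · intro z hz
    rw [starQuotient_dilate hr0.ne', hφ _ (hmem z hz)]

lemma ball_subset_ball_of_le {a b x y : ℝ} (hab : a ≤ b) (h : b - y ≤ a - x) :
    Metric.ball (a : ℂ) x ⊆ Metric.ball (b : ℂ) y := by
  apply Metric.ball_subset_ball'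
  rw [dist_eq_norm, ← ofReal_sub, norm_real, Real.norm_eq_abs, abs_of_nonpos (by linarith)]
  linarith

lemma ball_subset_ball_of_ge {a b x y : ℝ} (hab : b ≤ a) (h : a + x ≤ b + y) :
    Metric.ball (a : ℂ) x ⊆ Metric.ball (b : ℂ) y := by
  apply Metric.ball_subset_ball'
  rw [dist_eq_norm, ← ofReal_sub, norm_real, Real.norm_eq_abs, abs_of_nonneg (by linarith)]
  linarith

/-- The values of `z f'(z) / f(z)` on `|z| < R` lie in the disk with left endpoint `leftF2 R` and
a larger centre. -/
lemma ball_subset_of_left {R b y : ℝ} (hR0 : 0 < R) (hR1 : R < 1) (hy : leftF2 R = y)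
    (hb : centerF2 R ≤ b) :
    Metric.ball (centerF2 R : ℂ) (spreadF2 R) ⊆ Metric.ball (b : ℂ) (b - y) :=
  ball_subset_ball_of_le hb (by rw [centerF2_sub_spreadF2 hR0.le hR1, hy]; linarith)

lemma one_le_centerF2 {R : ℝ} (hR0 : 0 < R) (hR1 : R < 1) : 1 ≤ centerF2 R := by
  have := centerF2_mono le_rfl hR0.le hR1
  simpa [centerF2] using this

/-- The values of `z f'(z) / f(z)` on `|z| < R` lie in a disk around `1`. -/
lemma ball_subset_of_right {R y : ℝ} (hR0 : 0 < R) (hR1 : R < 1)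
    (hy : 4 * R + 2 * R ^ 2 = y * (1 - R ^ 2)) :
    Metric.ball (centerF2 R : ℂ) (spreadF2 R) ⊆ Metric.ball (1 : ℂ) y := by
  have h := one_sub_sq_pos hR0.le hR1
  have := ball_subset_ball_of_ge (a := centerF2 R) (b := 1) (x := spreadF2 R) (y := y)
    (one_le_centerF2 hR0 hR1) (by
      unfold centerF2 spreadF2
      rw [← add_div, div_le_iff₀ h]
      linarith)
  simpa using this

/-- A crude bound suffices, since the centres of the comparison disks used below with a prescribed
left endpoint (`√2`, `3/2`, `5/3`, `cosh 1`) all exceed `4/3`. -/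
lemma centerF2_le {R : ℝ} (hR0 : 0 < R) (hR : R ≤ 1 / 2) : centerF2 R ≤ 4 / 3 := by
  have h := one_sub_sq_pos hR0.le (by linarith : R < 1)
  unfold centerF2
  rw [div_le_div_iff₀ h (by norm_num)]
  nlinarith

/-! ### The extremal function. -/

lemma differentiableOn_extremalF2 : DifferentiableOn ℂ extremalF2 unitDisk := by
  unfold extremalF2
  refine DifferentiableOn.div (by fun_prop) (by fun_prop) fun z hz => pow_ne_zero 2 fun h => ?_
  rw [show z = -1 by linear_combination h, mem_unitDisk] at hz
  simp at hz

lemma one_add_ne_zero_of_mem {z : ℂ} (hz : z ∈ unitDisk) : 1 + z ≠ 0 := by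
  intro h
  rw [show z = -1 by linear_combination h, mem_unitDisk] at hz
  simp at hz

lemma one_sub_ne_zero_of_mem {z : ℂ} (hz : z ∈ unitDisk) : 1 - z ≠ 0 := by
  intro h
  rw [show z = 1 by linear_combination -h, mem_unitDisk] at hz
  simp at hz

lemma re_pos_of_div_one_add {z : ℂ} (hz : z ∈ unitDisk) : 0 < ((1 - z) / (1 + z)).re := by
  have h := mem_unitDisk.1 hz
  rw [norm_lt_iff zero_le_one] at h
  have hn : 0 < normSq (1 + z) := normSq_pos.2 (one_add_ne_zero_of_mem hz)
  rw [div_re, ← add_div]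
  apply div_pos _ hn
  simp only [sub_re, sub_im, add_re, add_im, one_re, one_im]
  nlinarith

lemma hasDerivAt_extremalF2 {z : ℂ} (hz : 1 + z ≠ 0) :
    HasDerivAt extremalF2
      (((1 - z) ^ 2 * (1 + z) - 4 * z * (1 - z)) / (1 + z) ^ 3) z := by
  have h1 : HasDerivAt (fun z : ℂ => 1 - z) (-1) z := by
    simpa using (hasDerivAt_id z).const_sub 1
  have h2 : HasDerivAt (fun z : ℂ => 1 + z) 1 z := by
    simpa using (hasDerivAt_id z).const_add 1
  refine (((hasDerivAt_id' z).mul (h1.pow 2)).div (h2.pow 2) (pow_ne_zero 2 hz)).congr_deriv ?_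
  simp
  field_simp
  ring

theorem extremalF2_mem : extremalF2 ∈ classF2 := by
  have hA : extremalF2 ∈ classA :=
    ⟨differentiableOn_extremalF2, by simp [extremalF2],
      by rw [(hasDerivAt_extremalF2 (z := 0) (by simp)).deriv]; simp⟩
  have hg : ∀ z ∈ unitDisk, HasDerivAt (fun z : ℂ => z * (1 - z) / (1 + z) ^ 2)
      (((1 - 2 * z) * (1 + z) - 2 * z * (1 - z)) / (1 + z) ^ 3) z := by
    intro z hz
    have h0 := one_add_ne_zero_of_mem hz
    have h1 : HasDerivAt (fun z : ℂ => 1 - z) (-1) z := by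
      simpa using (hasDerivAt_id z).const_sub 1
    have h2 : HasDerivAt (fun z : ℂ => 1 + z) 1 z := by
      simpa using (hasDerivAt_id z).const_add 1
    refine (((hasDerivAt_id' z).mul h1).div (h2.pow 2) (pow_ne_zero 2 h0)).congr_deriv ?_
    simp
    field_simp
    ring
  -- This `g` makes `p = (1-z)/(1+z)` and `q = 1-z`, extremal for the two logarithmic derivative
  -- bounds at positive `z`.
  refine ⟨hA, fun z => z * (1 - z) / (1 + z) ^ 2, ⟨fun z hz =>
    (hg z hz).differentiableAt.differentiableWithinAt, by simp, by
      rw [(hg 0 zero_mem_unitDisk).deriv]; simp⟩, fun z hz h0 => ?_, fun z hz h0 => ?_⟩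
  · have h1 := one_add_ne_zero_of_mem hz
    rw [show (1 + z) / z * (z * (1 - z) / (1 + z) ^ 2) = (1 - z) / (1 + z) by field_simp]
    exact re_pos_of_div_one_add hz
  · have h1 := one_add_ne_zero_of_mem hz
    have h2 := one_sub_ne_zero_of_mem hz
    rw [show extremalF2 z / (z * (1 - z) / (1 + z) ^ 2) - 1 = -z by
      unfold extremalF2; field_simp; ring]
    rw [norm_neg]
    exact mem_unitDisk.1 hz

/-- Along the positive axis the left endpoint of the value disk is attained; all sharpness
statements rest on this. -/
lemma starQuotient_extremalF2 {x : ℝ} (hx0 : 0 < x) (hx1 : x < 1) :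
    starQuotient extremalF2 (x : ℂ) = (leftF2 x : ℂ) := by
  have hx : (x : ℂ) ∈ unitDisk := by
    rw [mem_unitDisk, norm_real, Real.norm_eq_abs, abs_of_pos hx0]; exact hx1
  have h0 : (x : ℂ) ≠ 0 := by exact_mod_cast hx0.ne'
  have h1 := one_add_ne_zero_of_mem hx
  have h2 := one_sub_ne_zero_of_mem hx
  have h3 : (1 : ℂ) - (x : ℂ) ^ 2 ≠ 0 := by
    rw [show (1 : ℂ) - (x : ℂ) ^ 2 = (1 - x) * (1 + x) by ring]
    exact mul_ne_zero h2 h1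
  rw [starQuotient, Function.update_of_ne h0, (hasDerivAt_extremalF2 h1).deriv, extremalF2, leftF2]
  push_cast
  field_simp
  ring

/-! ### The sharpness criterion. -/

lemma continuousAt_leftF2 {R : ℝ} (hR0 : 0 < R) (hR1 : R < 1) : ContinuousAt leftF2 R := by
  have := (one_sub_sq_pos hR0.le hR1).ne'
  unfold leftF2
  fun_prop (disch := assumption)

/-- If `φ` omits the real numbers slightly below `leftF2 R`, then dilations of the extremal function
with factor larger than `R` are not in `𝒮*(φ)`. -/
theorem dilate_extremalF2_notMem {φ : ℂ → ℂ} {R m y : ℝ} (hR0 : 0 < R) (hR1 : R < 1)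
    (hy : leftF2 R = y) (hm : m < y)
    (hφ : ∀ t : ℝ, m < t → t < y → ∀ z ∈ unitDisk, φ z ≠ (t : ℂ)) {r : ℝ} (hRr : R < r)
    (hr1 : r ≤ 1) : dilate r extremalF2 ∉ starClass φ := by
  rintro ⟨-, -, w, -, hmap, -, hw⟩
  -- A point `x` just to the right of `R`, with `x < r`: at `x / r` the dilated extremal function
  -- has the value `leftF2 x`, which is among the omitted numbers.
  have hev : ∀ᶠ x in 𝓝[>] R, m < leftF2 x ∧ x < r ∧ R < x := by
    have h1 : ∀ᶠ x in 𝓝[>] R, m < leftF2 x :=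
      ((continuousAt_leftF2 hR0 hR1).eventually (lt_mem_nhds (by rw [hy]; exact hm))).filter_mono
        nhdsWithin_le_nhds
    have h2 : ∀ᶠ x in 𝓝[>] R, x < r := (eventually_lt_nhds hRr).filter_mono nhdsWithin_le_nhds
    filter_upwards [h1, h2, self_mem_nhdsWithin] with x a b c
    exact ⟨a, b, c⟩
  obtain ⟨x, hmx, hxr, hRx⟩ := hev.exists
  have hr0 : 0 < r := hR0.trans hRr
  have hx0 : 0 < x := hR0.trans hRx
  have hx1 : x < 1 := hxr.trans_le hr1
  have hz : ((x / r : ℝ) : ℂ) ∈ unitDisk := by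
    rw [mem_unitDisk, norm_real, Real.norm_eq_abs, abs_of_pos (div_pos hx0 hr0), div_lt_one hr0]
    exact hxr
  have h := hw _ hz
  rw [starQuotient_dilate hr0.ne', ← ofReal_mul, mul_div_cancel₀ _ hr0.ne',
    starQuotient_extremalF2 hx0 hx1] at h
  refine hφ _ hmx ?_ _ (hmap hz) h.symm
  rw [← hy]
  exact leftF2_strictAnti hR0.le hRx hx1

/-- A sufficient condition for `R` to be the sharp `𝒮*(φ)`-radius of `𝓕₂`. -/
theorem isSharpRadiusF2_of_rightInverse {φ ψ : ℂ → ℂ} {R m y : ℝ} {U : Set ℂ} (hR0 : 0 < R)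
    (hR1 : R < 1) (hy : leftF2 R = y) (hm : m < y)
    (homit : ∀ t : ℝ, m < t → t < y → ∀ z ∈ unitDisk, φ z ≠ (t : ℂ))
    (hU : Metric.ball (centerF2 R : ℂ) (spreadF2 R) ⊆ U)
    (hψ : DifferentiableOn ℂ ψ U) (hmap : Set.MapsTo ψ U unitDisk) (hψ1 : ψ 1 = 0)
    (hφ : ∀ u ∈ U, φ (ψ u) = u) : IsSharpRadiusF2 (starClass φ) R := by
  have hsharp : ∀ r : ℝ, R < r → r ≤ 1 → dilate r extremalF2 ∉ starClass φ := fun r h1 h2 =>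
    dilate_extremalF2_notMem hR0 hR1 hy hm homit h1 h2
  refine ⟨⟨mem_radiusSet_of_rightInverse hR0 hR1 hU hψ hmap hψ1 hφ, ?_⟩, hsharp⟩
  rintro s ⟨hs0, hs1, hs⟩
  by_contra! h
  exact hsharp s h hs1 (hs s hs0 le_rfl _ extremalF2_mem)

/-! ### Existence of the radius for univalent `φ`. -/

/-- For univalent `φ` membership of all smaller dilations in `𝒮*(φ)` passes to the limit. -/
lemma dilate_mem_starClass_of_lt {φ : ℂ → ℂ} (hφ : Set.InjOn φ unitDisk) {f : ℂ → ℂ}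
    (hf : f ∈ classF2) {R : ℝ} (hR0 : 0 < R) (hR1 : R ≤ 1)
    (h : ∀ r, 0 < r → r < R → dilate r f ∈ starClass φ) : dilate R f ∈ starClass φ := by
  have hR' : (R : ℂ) ≠ 0 := by exact_mod_cast hR0.ne'
  have hw : ∀ r, 0 < r → r < R → ∃ w : ℂ → ℂ, DifferentiableOn ℂ w unitDisk ∧
      Set.MapsTo w unitDisk unitDisk ∧ w 0 = 0 ∧
      ∀ z ∈ unitDisk, starQuotient f (r * z) = φ (w z) := by
    intro r h0 h1
    obtain ⟨-, -, w, h1, h2, h3, h4⟩ := h r h0 h1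
    exact ⟨w, h1, h2, h3, fun z hz => by rw [← h4 z hz, starQuotient_dilate h0.ne']⟩
  choose! w hw1 hw2 hw3 hw4 using hw
  -- A radius strictly between `R|z|` and `R`, so that `Rz / s z` is in the disk and `w (s z)` is
  -- one of the given functions.
  set s : ℂ → ℝ := fun z => R * ((1 + ‖z‖) / 2) with hs
  have hs0 : ∀ z, 0 < s z := fun z => by have := norm_nonneg z; simp only [hs]; positivity
  have hs1 : ∀ z ∈ unitDisk, s z < R := by
    intro z hz
    have := mem_unitDisk.1 hz
    simp only [hs]
    nlinarith
  have hmem : ∀ r, 0 < r → ∀ z : ℂ, R * ‖z‖ < r → (R : ℂ) * z / r ∈ unitDisk := by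
    intro r hr z hz
    rw [mem_unitDisk, norm_div, norm_mul, norm_real, norm_real, Real.norm_eq_abs,
      Real.norm_eq_abs, abs_of_pos hr, abs_of_pos hR0, div_lt_one hr]
    exact hz
  have hlt : ∀ z ∈ unitDisk, R * ‖z‖ < s z := by
    intro z hz
    have := mem_unitDisk.1 hz
    simp only [hs]
    nlinarith
  have hval : ∀ r, 0 < r → r < R → ∀ z : ℂ, R * ‖z‖ < r →
      φ (w r ((R : ℂ) * z / r)) = starQuotient f (R * z) := by
    intro r h0 h1 z hz
    rw [← hw4 r h0 h1 _ (hmem r h0 z hz), mul_div_cancel₀]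
    exact_mod_cast h0.ne'
  -- Injectivity of `φ` makes the value independent of the radius. Near `z0` the fixed radius `s z0`
  -- may therefore replace `s z`, which gives holomorphy.
  have hEq : ∀ r, 0 < r → r < R → ∀ z ∈ unitDisk, R * ‖z‖ < r →
      w (s z) ((R : ℂ) * z / s z) = w r ((R : ℂ) * z / r) := by
    intro r h0 h1 z hz hzr
    refine hφ (hw2 _ (hs0 z) (hs1 z hz) (hmem _ (hs0 z) z (hlt z hz)))
      (hw2 r h0 h1 (hmem r h0 z hzr)) ?_
    rw [hval _ (hs0 z) (hs1 z hz) z (hlt z hz), hval r h0 h1 z hzr]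
  refine ⟨dilate_mem_classA hR0 hR1 hf.1, fun z hz h0 => mul_ne_zero (inv_ne_zero hR')
      (classF2_ne_zero hf (mul_mem_unitDisk hR0 hR1 hz) (mul_ne_zero hR' h0)),
    fun z => w (s z) ((R : ℂ) * z / s z), ?_, ?_, ?_, ?_⟩
  · intro z0 hz0
    have hnear : ∀ᶠ z in 𝓝 z0, z ∈ unitDisk ∧ R * ‖z‖ < s z0 := by
      refine (isOpen_unitDisk.eventually_mem hz0).and ?_
      exact (by fun_prop : ContinuousAt (fun z : ℂ => R * ‖z‖) z0).eventually_lt_const (hlt z0 hz0)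
    have hd : DifferentiableAt ℂ (fun z => w (s z0) ((R : ℂ) * z / s z0)) z0 := by
      have h1 : DifferentiableAt ℂ (w (s z0)) ((R : ℂ) * z0 / s z0) :=
        (hw1 _ (hs0 z0) (hs1 z0 hz0)).differentiableAt
          (unitDisk_mem_nhds (hmem _ (hs0 z0) z0 (hlt z0 hz0)))
      exact h1.comp z0 (by fun_prop)
    refine (hd.congr_of_eventuallyEq ?_).differentiableWithinAt
    filter_upwards [hnear] with z hz
    exact hEq _ (hs0 z0) (hs1 z0 hz0) z hz.1 hz.2
  · exact fun z hz => hw2 _ (hs0 z) (hs1 z hz) (hmem _ (hs0 z) z (hlt z hz))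
  · simp only [mul_zero, zero_div]
    exact hw3 _ (hs0 0) (hs1 0 zero_mem_unitDisk)
  · intro z hz
    rw [starQuotient_dilate hR0.ne', hval _ (hs0 z) (hs1 z hz) z (hlt z hz)]

/-- For univalent `φ` the `𝒮*(φ)`-radius of `𝓕₂` exists as soon as some radius is admissible. -/
theorem radiusF2AtLeast_of_mem {φ : ℂ → ℂ} (hφ : Set.InjOn φ unitDisk) {c : ℝ}
    (hc : c ∈ radiusSet (starClass φ) classF2) : RadiusF2AtLeast (starClass φ) c := by
  have hbdd : BddAbove (radiusSet (starClass φ) classF2) := ⟨1, fun r hr => hr.2.1⟩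
  have hcS := le_csSup hbdd hc
  have hS0 := hc.1.trans_le hcS
  have hS1 : sSup (radiusSet (starClass φ) classF2) ≤ 1 := csSup_le ⟨c, hc⟩ fun r hr => hr.2.1
  refine ⟨_, ⟨⟨hS0, hS1, fun r hr0 hrS f hf => ?_⟩, fun r hr => le_csSup hbdd hr⟩, hcS⟩
  have hlt : ∀ r, 0 < r → r < sSup (radiusSet (starClass φ) classF2) →
      dilate r f ∈ starClass φ := by
    intro r h0 h1
    obtain ⟨t, ht, hrt⟩ := exists_lt_of_lt_csSup ⟨c, hc⟩ h1
    exact ht.2.2 r h0 hrt.le f hf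
  exact dilate_mem_starClass_of_lt hφ hf hr0 (hrS.trans hS1) fun t h0 h1 =>
    hlt t h0 (h1.trans_le hrS)

/-! ### The principal square root; disks with real centre. -/

lemma csqrt_sq (z : ℂ) : Complex.sqrt z ^ 2 = z := by
  rw [Complex.sqrt]
  exact_mod_cast Complex.cpow_nat_inv_pow z (n := 2) two_ne_zero

lemma csqrt_re_nonneg (z : ℂ) : 0 ≤ (Complex.sqrt z).re := by
  rw [Complex.sqrt, Complex.cpow_inv_two_re]
  exact Real.sqrt_nonneg _

lemma csqrt_injective : Function.Injective Complex.sqrt := fun z w h => by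
  rw [← csqrt_sq z, h, csqrt_sq]

lemma csqrt_sq_of_re_pos {v : ℂ} (hv : 0 < v.re) : Complex.sqrt (v ^ 2) = v := by
  rcases sq_eq_sq_iff_eq_or_eq_neg.1 (csqrt_sq (v ^ 2)) with h | h
  · exact h
  · have := csqrt_re_nonneg (v ^ 2)
    rw [h, neg_re] at this
    linarith

lemma csqrt_re_pos {z : ℂ} (hz : z ∈ slitPlane) : 0 < (Complex.sqrt z).re := by
  refine (csqrt_re_nonneg z).lt_of_ne' fun h => ?_
  have h2 := csqrt_sq z
  rw [mem_slitPlane_iff] at hz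
  rw [Complex.ext_iff, sq, mul_re, mul_im, h] at h2
  rcases hz with hz | hz
  · nlinarith [h2.1, sq_nonneg (Complex.sqrt z).im]
  · apply hz; rw [← h2.2]; ring

lemma mem_slitPlane_of_re_pos {z : ℂ} (hz : 0 < z.re) : z ∈ slitPlane :=
  mem_slitPlane_iff.2 (Or.inl hz)

lemma differentiableAt_csqrt_comp {g : ℂ → ℂ} {u : ℂ} (hg : DifferentiableAt ℂ g u)
    (h : g u ∈ slitPlane) : DifferentiableAt ℂ (fun u => Complex.sqrt (g u)) u :=
  (Complex.differentiableAt_sqrt h).comp u hg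

lemma lt_of_mem_ball_left {b y : ℝ} {u : ℂ} (hu : u ∈ Metric.ball (b : ℂ) (b - y)) :
    y < u.re := by
  rw [Metric.mem_ball, dist_eq_norm] at hu
  have h := (Complex.abs_re_le_norm _).trans_lt hu
  rw [sub_re, ofReal_re, abs_lt] at h
  linarith [h.1]

lemma mem_ball_ofReal {b c : ℝ} (hc : 0 ≤ c) {u : ℂ} :
    u ∈ Metric.ball (b : ℂ) c ↔ (u.re - b) ^ 2 + u.im ^ 2 < c ^ 2 := by
  rw [Metric.mem_ball, dist_eq_norm, norm_lt_iff hc, sub_re, sub_im, ofReal_re, ofReal_im, sub_zero]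

lemma leftF2_eq {R δ : ℝ} (hR0 : 0 < R) (hR1 : R < 1) (h : 4 * R = δ * (1 - R ^ 2)) :
    leftF2 R = 1 - δ := by
  rw [leftF2, h, mul_div_assoc, div_self (one_sub_sq_pos hR0.le hR1).ne', mul_one]

/-- The number is the positive root of `δR² + 4R - δ = 0`, rationalised; the equation says that
`leftF2 R = 1 - δ`. -/
lemma div_two_add_sqrt_spec {δ : ℝ} (h0 : 0 < δ) (h1 : δ ≤ 1) :
    0 < δ / (2 + √(4 + δ ^ 2)) ∧ δ / (2 + √(4 + δ ^ 2)) ≤ 1 / 4 ∧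
      4 * (δ / (2 + √(4 + δ ^ 2))) = δ * (1 - (δ / (2 + √(4 + δ ^ 2))) ^ 2) := by
  have hS : √(4 + δ ^ 2) ^ 2 = 4 + δ ^ 2 := Real.sq_sqrt (by positivity)
  have hS2 : 2 ≤ √(4 + δ ^ 2) := Real.le_sqrt_of_sq_le (by nlinarith)
  set S := √(4 + δ ^ 2)
  have hpos : 0 < 2 + S := by linarith
  refine ⟨by positivity, ?_, ?_⟩
  · rw [div_le_div_iff₀ hpos (by norm_num)]; linarith
  · field_simp
    linear_combination -hS

/-! ### Half-planes: starlike functions of order `α`. -/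

theorem isSharpRadiusF2_starOrder {α : ℝ} (h0 : 0 ≤ α) (h1 : α < 1) :
    IsSharpRadiusF2 (starOrder α) ((1 - α) / (2 + √(4 + (α - 1) ^ 2))) := by
  rw [show (α - 1) ^ 2 = (1 - α) ^ 2 by ring]
  obtain ⟨hR0, hR1, hR⟩ := div_two_add_sqrt_spec (sub_pos.2 h1) (by linarith)
  set R := (1 - α) / (2 + √(4 + (1 - α) ^ 2))
  have hR1' : R < 1 := by linarith
  have hl := leftF2_eq hR0 hR1' hR
  have hlt : ∀ u ∈ {u : ℂ | α < u.re}, ‖u - 1‖ < ‖u + 1 - 2 * (α : ℂ)‖ := by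
    intro u hu
    rw [Set.mem_ofPred_eq] at hu
    rw [norm_lt_norm_iff]
    simp
    nlinarith
  refine isSharpRadiusF2_of_rightInverse (ψ := fun u => (u - 1) / (u + 1 - 2 * (α : ℂ)))
    (y := α) (m := α - 1) (U := {u | α < u.re}) hR0 hR1' (by rw [hl]; ring) (by linarith) ?_
    (fun u hu => lt_of_mem_ball_left (ball_subset_of_left hR0 hR1' (by rw [hl]; ring) le_rfl hu))
    ?_ ?_ (by simp) ?_
  · intro t _ ht z hz h
    rw [div_eq_iff (one_sub_ne_zero_of_mem hz)] at h
    have hre := re_pos_of_div_one_add (z := -z) (by rw [mem_unitDisk, norm_neg]; exact mem_unitDisk.1 hz)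
    have hne := one_sub_ne_zero_of_mem hz
    have e : (1 - -z) / (1 + -z) = (((t - α) / (1 - α) : ℝ) : ℂ) := by
      have h2 : (1 : ℂ) - α ≠ 0 := by exact_mod_cast (sub_pos.2 h1).ne'
      rw [sub_neg_eq_add, ← sub_eq_add_neg]
      push_cast
      rw [div_eq_div_iff hne h2]
      linear_combination h
    rw [e, ofReal_re] at hre
    exact absurd hre (not_lt.2 (div_nonpos_of_nonpos_of_nonneg (by linarith) (by linarith)))
  · exact DifferentiableOn.div (by fun_prop) (by fun_prop) fun u hu =>
      ne_zero_of_norm_lt (hlt u hu)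
  · exact fun u hu => mem_unitDisk.2 (norm_div_lt_one (hlt u hu))
  · intro u hu
    have hne := ne_zero_of_norm_lt (hlt u hu)
    have h2 : (1 : ℂ) - α ≠ 0 := by exact_mod_cast (sub_pos.2 h1).ne'
    have e : 1 - (u - 1) / (u + 1 - 2 * (α : ℂ)) = 2 * (1 - α) / (u + 1 - 2 * (α : ℂ)) := by
      field_simp; ring
    simp only [e]
    field_simp
    ring

/-! ### The lemniscate of Bernoulli. -/

lemma sqrt_two_bounds : (1.414213 : ℝ) < √2 ∧ √2 < 1.414214 :=
  ⟨Real.lt_sqrt_of_sq_lt (by norm_num), (Real.sqrt_lt' (by norm_num)).2 (by norm_num)⟩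

lemma sq_sqrt_two : √2 ^ 2 = (2 : ℝ) := Real.sq_sqrt (by norm_num)

/-- The inverse is `u² - 1`. If `|u-1| < √2-1`, then `|u²-1| ≤ |u-1|(2+|u-1|) < (√2-1)(√2+1) = 1`.
The number `R` makes the right endpoint of the value disk equal to `√2`. -/
theorem radiusF2AtLeast_starBernoulli : RadiusF2AtLeast starBernoulli ((√5 - 2) / (1 + √2)) := by
  have h5 : √5 ^ 2 = (5 : ℝ) := Real.sq_sqrt (by norm_num)
  have h51 : 2 < √5 := Real.lt_sqrt_of_sq_lt (by norm_num)
  have h52 : √5 < 3 := (Real.sqrt_lt' (by norm_num)).2 (by norm_num)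
  have h2 := sq_sqrt_two
  obtain ⟨h21, h22⟩ := sqrt_two_bounds
  set R := (√5 - 2) / (1 + √2) with hRdef
  have hR0 : 0 < R := div_pos (by linarith) (by linarith)
  have hR1 : R < 1 := by rw [hRdef, div_lt_one (by linarith)]; linarith
  have hRk : R * (1 + √2) = √5 - 2 := div_mul_cancel₀ _ (by linarith)
  have hR : 4 * R + 2 * R ^ 2 = (√2 - 1) * (1 - R ^ 2) := by
    have h : (1 + √2) * (4 * R + 2 * R ^ 2) = (1 + √2) * ((√2 - 1) * (1 - R ^ 2)) := by
      linear_combination (4 + R * (1 + √2) + √5 - 2) * hRk + h5 - h2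
    exact mul_left_cancel₀ (by linarith) h
  refine radiusF2AtLeast_of_mem ?_ (mem_radiusSet_of_rightInverse (ψ := fun u => u ^ 2 - 1)
    (U := Metric.ball 1 (√2 - 1)) hR0 hR1 (ball_subset_of_right hR0 hR1 hR) (by fun_prop) ?_
    (by simp) ?_)
  · intro z _ w _ h
    simpa using csqrt_injective h
  · intro u hu
    rw [mem_unitDisk]
    rw [Metric.mem_ball, dist_eq_norm] at hu
    have e : u ^ 2 - 1 = (u - 1) * (2 + (u - 1)) := by ring
    have h3 : ‖2 + (u - 1)‖ < √2 + 1 := by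
      refine (norm_add_le _ _).trans_lt ?_
      rw [Complex.norm_two]
      linarith
    simp only [e]
    rw [norm_mul]
    nlinarith [norm_nonneg (u - 1), norm_nonneg (2 + (u - 1))]
  · intro u hu
    have h3 := lt_of_mem_ball_left (b := 1) (y := 2 - √2) (u := u)
      (by simpa [show (1 : ℝ) - (2 - √2) = √2 - 1 by ring] using hu)
    rw [show 1 + (u ^ 2 - 1) = u ^ 2 by ring]
    exact csqrt_sq_of_re_pos (by linarith)

/-! ### The cardioid. -/

lemma sqrt_ten_sub_three_spec : 0 < √10 - 3 ∧ √10 - 3 ≤ 1 / 2 ∧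
    4 * (√10 - 3) = 2 / 3 * (1 - (√10 - 3) ^ 2) := by
  have h : √10 ^ 2 = (10 : ℝ) := Real.sq_sqrt (by norm_num)
  have h1 : 3 < √10 := Real.lt_sqrt_of_sq_lt (by norm_num)
  have h2 : √10 < 3.5 := (Real.sqrt_lt' (by norm_num)).2 (by norm_num)
  exact ⟨by linarith, by linarith, by linear_combination (2 / 3) * h⟩

/-- Completing the square, `φ(z) = 1/3 + (2/3)(1+z)²`. For `s = 1+z` the disk `|u-5/3| < 4/3`
becomes `|s²-2| < 2`, that is `|s|⁴ < 4 Re s² ≤ 4 (Re s)²`; hence `|s|² < 2 Re s`, which is `|s-1| <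
1`. -/
theorem isSharpRadiusF2_starC : IsSharpRadiusF2 starC (√10 - 3) := by
  obtain ⟨hR0, hR1, hR⟩ := sqrt_ten_sub_three_spec
  have hR1' : √10 - 3 < 1 := by linarith
  have hl : leftF2 (√10 - 3) = 1 / 3 := (leftF2_eq hR0 hR1' hR).trans (by norm_num)
  have hre : ∀ u ∈ Metric.ball ((5 / 3 : ℝ) : ℂ) (5 / 3 - 1 / 3), 0 < ((3 * u - 1) / 2).re := by
    intro u hu
    have := lt_of_mem_ball_left hu
    simp
    linarith
  refine isSharpRadiusF2_of_rightInverse (ψ := fun u => -1 + Complex.sqrt ((3 * u - 1) / 2))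
    (y := 1 / 3) (m := 0) hR0 hR1' hl (by norm_num) ?_
    (ball_subset_of_left hR0 hR1' hl ((centerF2_le hR0 hR1).trans (by norm_num : _ ≤ (5 / 3 : ℝ))))
    ?_ ?_ (by norm_num) ?_
  · intro t _ ht z hz h
    have h1 : (z + 1) ^ 2 = (((3 * t - 1) / 2 : ℝ) : ℂ) := by
      push_cast
      linear_combination (3 / 2) * h
    have hz1 := neg_lt_of_abs_lt ((Complex.abs_re_le_norm z).trans_lt (mem_unitDisk.1 hz))
    rw [Complex.ext_iff, sq, mul_re, mul_im, ofReal_re, ofReal_im] at h1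
    simp only [add_re, add_im, one_re, one_im, add_zero] at h1
    have h2 : z.im = 0 := by
      have : (2 * (z.re + 1)) * z.im = 0 := by linear_combination h1.2
      rcases mul_eq_zero.1 this with h | h
      · linarith
      · exact h
    have h3 := h1.1
    rw [h2] at h3
    nlinarith [sq_nonneg (z.re + 1)]
  · intro u hu
    have : DifferentiableAt ℂ (fun u => Complex.sqrt ((3 * u - 1) / 2)) u :=
      differentiableAt_csqrt_comp (by fun_prop) (mem_slitPlane_of_re_pos (hre u hu))
    exact (this.const_add (-1)).differentiableWithinAt
  · intro u hu
    have hs := csqrt_re_pos (mem_slitPlane_of_re_pos (hre u hu))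
    have hs2 := csqrt_sq ((3 * u - 1) / 2)
    rw [mem_ball_ofReal (by norm_num)] at hu
    set s := Complex.sqrt ((3 * u - 1) / 2)
    have e : u = (2 * s ^ 2 + 1) / 3 := by rw [hs2]; ring
    have e1 : u.re = (2 * (s.re ^ 2 - s.im ^ 2) + 1) / 3 := by
      rw [e]; simp [sq]
    have e2 : u.im = 4 * s.re * s.im / 3 := by
      rw [e]; simp [sq]; ring
    rw [e1, e2] at hu
    rw [mem_unitDisk, norm_lt_iff zero_le_one]
    simp only [add_re, add_im, neg_re, neg_im, one_re, one_im]
    have : s.re ^ 2 + s.im ^ 2 < 2 * s.re := by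
      refine lt_of_pow_lt_pow_left₀ 2 (by linarith) ?_
      nlinarith [sq_nonneg s.im]
    nlinarith
  · intro u hu
    linear_combination (2 / 3) * csqrt_sq ((3 * u - 1) / 2)

/-! ### The lune. -/

/-- Solving `u = z + √(1+z²)` gives `z = (u²-1)/(2u)`, so the lune is `|u²-1| < 2|u|`, `Re u > 0`.
It contains `|u-√2| < 1`, where `|u|²+1 < 2√2 Re u`. The branch is right because `√(1+z²) =
(u+1/u)/2` has positive real part. -/
theorem isSharpRadiusF2_starLune :
    IsSharpRadiusF2 starLune ((2 - √2) / (2 + √(10 - 4 * √2))) := by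
  have h2 := sq_sqrt_two
  obtain ⟨h21, h22⟩ := sqrt_two_bounds
  rw [show 10 - 4 * √2 = 4 + (2 - √2) ^ 2 by linear_combination -h2]
  obtain ⟨hR0, hR1, hR⟩ := div_two_add_sqrt_spec (δ := 2 - √2) (by linarith) (by linarith)
  set R := (2 - √2) / (2 + √(4 + (2 - √2) ^ 2))
  have hR1' : R < 1 := by linarith
  have hl : leftF2 R = √2 - 1 := (leftF2_eq hR0 hR1' hR).trans (by ring)
  have hre : ∀ u ∈ Metric.ball ((√2 : ℝ) : ℂ) (√2 - (√2 - 1)), 0 < u.re := by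
    intro u hu
    have := lt_of_mem_ball_left hu
    linarith
  have hne : ∀ u ∈ Metric.ball ((√2 : ℝ) : ℂ) (√2 - (√2 - 1)), u ≠ 0 := by
    intro u hu h
    have := hre u hu
    simp [h] at this
  refine isSharpRadiusF2_of_rightInverse (ψ := fun u => (u ^ 2 - 1) / (2 * u))
    (y := √2 - 1) (m := 0) hR0 hR1' hl (by linarith) ?_
    (ball_subset_of_left (b := √2) hR0 hR1' hl
      ((centerF2_le hR0 (by linarith)).trans (by linarith)))
    ?_ ?_ (by norm_num) ?_
  · intro t ht0 ht z hz h
    have h0 : ((t : ℂ) - z) ^ 2 = 1 + z ^ 2 := by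
      rw [← h, add_sub_cancel_left, csqrt_sq]
    have ht0' : (t : ℂ) ≠ 0 := by exact_mod_cast ht0.ne'
    have h1 : z = (((t ^ 2 - 1) / (2 * t) : ℝ) : ℂ) := by
      push_cast
      field_simp
      linear_combination -h0
    rw [mem_unitDisk, h1, norm_real, Real.norm_eq_abs, abs_lt, lt_div_iff₀ (by linarith)] at hz
    nlinarith [hz.1]
  · exact DifferentiableOn.div (by fun_prop) (by fun_prop) fun u hu =>
      mul_ne_zero two_ne_zero (hne u hu)
  · intro u hu
    have hr := hre u hu
    rw [mem_ball_ofReal (by linarith)] at hu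
    refine mem_unitDisk.2 (norm_div_lt_one ?_)
    rw [norm_lt_norm_iff]
    simp only [sq, sub_re, sub_im, mul_re, mul_im, one_re, one_im, re_ofNat, im_ofNat]
    have h3 : u.re ^ 2 + u.im ^ 2 + 1 < 2 * √2 * u.re := by nlinarith
    have h4 : (u.re ^ 2 + u.im ^ 2 + 1) ^ 2 < 8 * u.re ^ 2 := by
      have := pow_lt_pow_left₀ h3 (by positivity) two_ne_zero
      calc _ < _ := this
        _ = _ := by linear_combination 4 * u.re ^ 2 * h2
    nlinarith [sq_nonneg u.im]
  · intro u hu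
    have h0 := hne u hu
    have hr := hre u hu
    have e : 1 + ((u ^ 2 - 1) / (2 * u)) ^ 2 = ((u + u⁻¹) / 2) ^ 2 := by field_simp; ring
    rw [e, csqrt_sq_of_re_pos]
    · field_simp; ring
    · have : 0 < (u⁻¹).re := by
        rw [inv_re]; exact div_pos hr (normSq_pos.2 h0)
      simp
      rw [inv_re] at this
      linarith

/-! ### The rational function. -/

lemma kConst_eq : kConst = ((√2 + 1 : ℝ) : ℂ) := by simp [kConst]

/-- With `σ = (k+1)/(1+z)` one has `φ(z) = φ(-1) + √2/(σ(σ-1))`, where `φ(-1) = 2√2-2`, and `|z| <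
1` means `Re σ > (2+√2)/2`. Thus `Q = σ(σ-1)` and `σ = 1/2 + √(Q+1/4)`. Inversion at the left
endpoint maps the disk to `Re Q > (√2+1)/2`, and `(Re √(Q+1/4))² ≥ Re(Q+1/4) > ((1+√2)/2)²`. -/
theorem isSharpRadiusF2_starR :
    IsSharpRadiusF2 starR ((3 - 2 * √2) / (2 + √(21 - 12 * √2))) := by
  have h2 := sq_sqrt_two
  obtain ⟨h21, h22⟩ := sqrt_two_bounds
  rw [show 21 - 12 * √2 = 4 + (3 - 2 * √2) ^ 2 by linear_combination -4 * h2]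
  obtain ⟨hR0, hR1, hR⟩ := div_two_add_sqrt_spec (δ := 3 - 2 * √2) (by linarith) (by linarith)
  set R := (3 - 2 * √2) / (2 + √(4 + (3 - 2 * √2) ^ 2))
  have hR1' : R < 1 := by linarith
  have hl : leftF2 R = 2 * √2 - 2 := (leftF2_eq hR0 hR1' hR).trans (by ring)
  set U := Metric.ball ((√2 : ℝ) : ℂ) (√2 - (2 * √2 - 2)) with hU
  set Q : ℂ → ℂ := fun u => (√2 : ℝ) / (u - (2 * √2 - 2 : ℝ)) with hQ
  have hre : ∀ u ∈ U, 0 < (u - (2 * √2 - 2 : ℝ)).re := by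
    intro u hu
    have := lt_of_mem_ball_left hu
    rw [sub_re, ofReal_re]
    linarith
  have hne : ∀ u ∈ U, u - (2 * √2 - 2 : ℝ) ≠ 0 := by
    intro u hu h
    exact (hre u hu).ne' (by rw [h, zero_re])
  have hQre : ∀ u ∈ U, (√2 + 1) / 2 < (Q u).re := by
    intro u hu
    have hr := hre u hu
    have hn := normSq_pos.2 (hne u hu)
    rw [hU, mem_ball_ofReal (by linarith)] at hu
    simp only [hQ]
    rw [div_eq_mul_inv ((√2 : ℝ) : ℂ), re_ofReal_mul, inv_re, ← mul_div_assoc, div_lt_div_iff₀ two_pos hn,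
      normSq_apply]
    rw [sub_re, ofReal_re] at hr
    rw [sub_re, ofReal_re, sub_im, ofReal_im]
    have h3 : (u.re - (2 * √2 - 2)) ^ 2 + u.im ^ 2 <
        2 * (2 - √2) * (u.re - (2 * √2 - 2)) := by nlinarith
    nlinarith [mul_lt_mul_of_pos_left h3 (by linarith : 0 < √2 + 1)]
  have hpos : ∀ u ∈ U, 0 < (Q u + 1 / 4).re := by
    intro u hu
    have := hQre u hu
    simp only [add_re, one_re, div_ofNat_re]
    linarith
  have hsre : ∀ u ∈ U, (1 + √2) / 2 < (Complex.sqrt (Q u + 1 / 4)).re := by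
    intro u hu
    have h3 := hQre u hu
    have h4 := csqrt_re_pos (mem_slitPlane_of_re_pos (hpos u hu))
    have h5 := congrArg Complex.re (csqrt_sq (Q u + 1 / 4))
    rw [sq, mul_re] at h5
    simp only [add_re, one_re, div_ofNat_re] at h5
    refine lt_of_pow_lt_pow_left₀ 2 h4.le ?_
    nlinarith [mul_self_nonneg (Complex.sqrt (Q u + 1 / 4)).im]
  have hs0 : ∀ u ∈ U, 1 / 2 + Complex.sqrt (Q u + 1 / 4) ≠ 0 := by
    intro u hu h
    have := congrArg Complex.re h
    simp only [add_re, one_re, div_ofNat_re, zero_re] at this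
    linarith [hsre u hu]
  refine isSharpRadiusF2_of_rightInverse
    (ψ := fun u => -1 + (2 + √2 : ℝ) / (1 / 2 + Complex.sqrt (Q u + 1 / 4)))
    (y := 2 * √2 - 2) (m := 0) hR0 hR1' hl (by linarith) ?_
    (ball_subset_of_left (b := √2) hR0 hR1' hl
      ((centerF2_le hR0 (by linarith)).trans (by linarith)))
    ?_ ?_ ?_ ?_
  · intro t ht0 ht z hz h
    have hk : kConst ^ 2 - kConst * z ≠ 0 := by
      intro h0
      have h3 := mem_unitDisk.1 hz
      have hk0 : kConst ≠ 0 := by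
        rw [kConst_eq]; exact_mod_cast (by linarith : √2 + 1 ≠ 0)
      have : z = kConst := mul_left_cancel₀ hk0 (by linear_combination -h0)
      rw [this, kConst_eq, norm_real, Real.norm_eq_abs, abs_of_pos (by linarith)] at h3
      linarith
    have h3 : kConst ^ 2 + z ^ 2 = t * (kConst ^ 2 - kConst * z) := by
      rw [← h, add_mul, one_mul, div_mul_cancel₀ _ hk]; ring
    rw [kConst_eq, Complex.ext_iff] at h3
    simp only [sq, add_re, add_im, sub_re, sub_im, mul_re, mul_im, ofReal_re, ofReal_im] at h3
    rw [mem_unitDisk, norm_lt_iff zero_le_one] at hz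
    obtain ⟨h4, h5⟩ := h3
    have hy : z.im * (2 * z.re + t * (√2 + 1)) = 0 := by linear_combination h5
    set k := √2 + 1 with hk
    have hk2 : k ^ 2 = 2 * k + 1 := by rw [hk]; linear_combination h2
    -- The equation `φ(z) = t` is `z² + tkz + k²(1-t) = 0`, with discriminant `k²((t+2)²-8) < 0`.
    -- Its roots are conjugate, with `|z|² = k²(1-t) > k²(3-2√2) = 1`.
    have ht2 : (t + 2) ^ 2 < 8 := by nlinarith
    rcases mul_eq_zero.1 hy with h6 | h6
    · rw [h6] at h4
      nlinarith [sq_nonneg (2 * z.re + t * k), mul_pos (by positivity : 0 < k ^ 2) (sub_pos.2 ht2)]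
    · have h7 : z.re = -(t * k) / 2 := by linarith
      have h8 : z.re ^ 2 + z.im ^ 2 = k ^ 2 * (1 - t) := by
        linear_combination (-1) * h4 + z.re * h6
      have h9 : k ^ 2 * (1 - (2 * √2 - 2)) = 1 := by
        rw [hk]; linear_combination (-1 - 2 * √2) * h2
      nlinarith [mul_pos (by positivity : 0 < k ^ 2) (sub_pos.2 ht)]
  · intro u hu
    have hQd : DifferentiableAt ℂ (fun u => Q u + 1 / 4) u := by
      have := hne u hu
      simp only [hQ]
      fun_prop (disch := assumption)
    have hsd : DifferentiableAt ℂ (fun u => Complex.sqrt (Q u + 1 / 4)) u :=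
      differentiableAt_csqrt_comp hQd (mem_slitPlane_of_re_pos (hpos u hu))
    exact (((differentiableAt_const _).div (hsd.const_add _) (hs0 u hu)).const_add _)
      |>.differentiableWithinAt
  · intro u hu
    have h3 := hsre u hu
    have h4 := hs0 u hu
    rw [mem_unitDisk]
    simp only
    set s := Complex.sqrt (Q u + 1 / 4)
    have e : -1 + (2 + √2 : ℝ) / (1 / 2 + s) = ((2 + √2 : ℝ) - (1 / 2 + s)) / (1 / 2 + s) := by
      rw [sub_div, div_self h4]; ring
    rw [e]
    refine norm_div_lt_one ?_
    rw [norm_lt_norm_iff]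
    simp only [add_re, add_im, sub_re, sub_im, ofReal_re, ofReal_im, one_re, one_im, div_ofNat_re,
      div_ofNat_im]
    nlinarith
  · have e : Q 1 + 1 / 4 = (((3 + 2 * √2) / 2 : ℝ) : ℂ) ^ 2 := by
      have h3 : (1 : ℝ) - (2 * √2 - 2) ≠ 0 := by linarith
      have h4 : √2 / ((1 : ℝ) - (2 * √2 - 2)) = 4 + 3 * √2 := by
        rw [div_eq_iff h3]; linear_combination 6 * h2
      have h5 : Q 1 = ((4 + 3 * √2 : ℝ) : ℂ) := by rw [← h4]; simp only [hQ]; push_cast; rfl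
      rw [h5]
      have h6 : 4 + 3 * √2 + 1 / 4 = ((3 + 2 * √2) / 2) ^ 2 := by linear_combination -h2
      rw [← ofReal_pow, ← h6]; push_cast; ring
    simp only [e]
    rw [csqrt_sq_of_re_pos (by rw [ofReal_re]; linarith)]
    have h3 : (1 : ℂ) / 2 + ((3 + 2 * √2) / 2 : ℝ) = ((2 + √2 : ℝ) : ℂ) := by push_cast; ring
    have h4 : ((2 + √2 : ℝ) : ℂ) ≠ 0 := by exact_mod_cast (by linarith : 2 + √2 ≠ 0)
    rw [h3, div_self h4]
    ring
  · intro u hu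
    have hs2 := csqrt_sq (Q u + 1 / 4)
    have hQu : Q u * (u - (2 * √2 - 2 : ℝ)) = (√2 : ℝ) := div_mul_cancel₀ _ (hne u hu)
    have hσ := hs0 u hu
    have hQ0 : Q u ≠ 0 := by
      intro h
      have := hQre u hu
      rw [h, zero_re] at this
      linarith
    have hs1 : 1 / 2 + Complex.sqrt (Q u + 1 / 4) - 1 ≠ 0 := by
      intro h
      apply hQ0
      linear_combination -hs2 + h * (1 / 2 + Complex.sqrt (Q u + 1 / 4))
    have hc2 : ((√2 : ℝ) : ℂ) ^ 2 = 2 := by exact_mod_cast h2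
    have hk0 : ((√2 : ℝ) : ℂ) + 1 ≠ 0 := by exact_mod_cast (by linarith : √2 + 1 ≠ 0)
    have hk1 : ((√2 : ℝ) : ℂ) + 2 ≠ 0 := by exact_mod_cast (by linarith : √2 + 2 ≠ 0)
    simp only [kConst]
    push_cast at hQu ⊢
    set c : ℂ := ((√2 : ℝ) : ℂ)
    set σ : ℂ := 1 / 2 + Complex.sqrt (Q u + 1 / 4) with hσdef
    have hσQ : σ * (σ - 1) = Q u := by rw [hσdef]; linear_combination hs2
    have hu' : u = 2 * c - 2 + c / (σ * (σ - 1)) := by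
      rw [hσQ, eq_comm, ← eq_sub_iff_add_eq', div_eq_iff hQ0]; linear_combination -hQu
    have e : (c + 1) ^ 2 - (c + 1) * (-1 + (2 + c) / σ) = (c + 1) * (c + 2) * (σ - 1) / σ := by
      field_simp; ring
    have hσ1 : σ - 1 ≠ 0 := hs1
    rw [hu', e]
    field_simp
    linear_combination (-(2 * c + 3) * σ ^ 2 + (2 * c + 4) * σ - (c + 2)) * hc2

/-! ### The exponential function. -/

lemma sinh_le_mul_cosh {x : ℝ} (hx : 0 ≤ x) : Real.sinh x ≤ x * Real.cosh x := by
  have hmono : MonotoneOn (fun x => x * Real.cosh x - Real.sinh x) (Set.Ici 0) := by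
    refine monotoneOn_of_hasDerivWithinAt_nonneg (convex_Ici 0) (by fun_prop)
      (f' := fun x => x * Real.sinh x) (fun x _ => ?_) fun x hx => ?_
    · have := ((hasDerivAt_id' x).mul (Real.hasDerivAt_cosh x)).sub (Real.hasDerivAt_sinh x)
      exact (this.congr_deriv (by ring)).hasDerivWithinAt
    · rw [interior_Ici] at hx
      exact mul_nonneg hx.le (Real.sinh_nonneg_iff.2 hx.le)
  have := hmono Set.self_mem_Ici hx hx
  simpa using this

lemma hasDerivAt_exp_sq_div_two (c x : ℝ) :
    HasDerivAt (fun x => Real.exp (c * x ^ 2 / 2)) (Real.exp (c * x ^ 2 / 2) * (c * x)) x := by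
  have : HasDerivAt (fun x : ℝ => c * x ^ 2 / 2) (c * x) x :=
    (((hasDerivAt_pow 2 x).const_mul c).div_const 2).congr_deriv (by simp; ring)
  exact this.exp

/-- The logarithmic derivative is `tanh x - x ≤ 0`. In the companion for `cos` it is `x - tan x ≤
0`. -/
lemma antitoneOn_cosh_mul_exp :
    AntitoneOn (fun x => Real.cosh x * Real.exp ((-1) * x ^ 2 / 2)) (Set.Ici 0) := by
  refine antitoneOn_of_hasDerivWithinAt_nonpos (convex_Ici 0) (by fun_prop)
    (f' := fun x => (Real.sinh x - x * Real.cosh x) * Real.exp ((-1) * x ^ 2 / 2))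
    (fun x _ => ?_) fun x hx => ?_
  · have := (Real.hasDerivAt_cosh x).mul (hasDerivAt_exp_sq_div_two (-1) x)
    exact (this.congr_deriv (by ring)).hasDerivWithinAt
  · rw [interior_Ici] at hx
    exact mul_nonpos_of_nonpos_of_nonneg (by linarith [sinh_le_mul_cosh hx.le])
      (Real.exp_pos _).le

lemma antitoneOn_cos_mul_exp :
    AntitoneOn (fun x => Real.cos x * Real.exp (1 * x ^ 2 / 2)) (Set.Icc 0 (Real.pi / 2)) := by
  refine antitoneOn_of_hasDerivWithinAt_nonpos (convex_Icc 0 _) (by fun_prop)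
    (f' := fun x => (x * Real.cos x - Real.sin x) * Real.exp (1 * x ^ 2 / 2))
    (fun x _ => ?_) fun x hx => ?_
  · have := (Real.hasDerivAt_cos x).mul (hasDerivAt_exp_sq_div_two 1 x)
    exact (this.congr_deriv (by ring)).hasDerivWithinAt
  · rw [interior_Icc] at hx
    have hc : 0 < Real.cos x := Real.cos_pos_of_mem_Ioo ⟨by linarith [hx.1, Real.pi_pos], hx.2⟩
    have := Real.le_tan hx.1.le hx.2
    rw [Real.tan_eq_sin_div_cos, le_div_iff₀ hc] at this
    exact mul_nonpos_of_nonpos_of_nonneg (by linarith) (Real.exp_pos _).le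

lemma cos_le_exp_neg_sq {y : ℝ} (hy : |y| ≤ Real.pi / 2) :
    Real.cos y ≤ Real.exp (-y ^ 2 / 2) := by
  have h := antitoneOn_cos_mul_exp ⟨le_rfl, by positivity⟩ ⟨abs_nonneg y, hy⟩ (abs_nonneg y)
  simp only [Real.cos_abs, sq_abs, Real.cos_zero] at h
  have e : -y ^ 2 / 2 = -(1 * y ^ 2 / 2) := by ring
  rw [e, Real.exp_neg, ← one_div, le_div_iff₀ (Real.exp_pos _)]
  simpa using h

/-- For `u = exp(x+iy)` the disk `|u - cosh 1| < sinh 1`, with diameter `[1/e, e]`, is `cosh x <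
cosh 1 cos y`. If `x²+y² ≥ 1` and `|x| < 1`, Gaussian comparison gives `cosh 1 cos y ≤ cosh 1
exp(-y²/2) ≤ cosh 1 exp((x²-1)/2) ≤ cosh x`. -/
lemma sq_add_sq_lt_one_of_cosh_lt {x y : ℝ} (hy : |y| ≤ Real.pi / 2)
    (h : Real.cosh x < Real.cosh 1 * Real.cos y) : x ^ 2 + y ^ 2 < 1 := by
  have hc := Real.cosh_pos 1
  by_contra! hge
  rcases le_or_gt 1 |x| with hx | hx
  · have h1 : Real.cosh 1 ≤ Real.cosh x := Real.cosh_le_cosh.2 (by simpa using hx)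
    nlinarith [Real.cos_le_one y]
  · have h1 := antitoneOn_cosh_mul_exp (abs_nonneg x)
      (Set.mem_Ici.2 zero_le_one) hx.le
    simp only [Real.cosh_abs, sq_abs] at h1
    have h2 := cos_le_exp_neg_sq hy
    have h3 : Real.exp (-y ^ 2 / 2) ≤ Real.exp ((x ^ 2 - 1) / 2) :=
      Real.exp_le_exp.2 (by linarith)
    have h4 : Real.cosh 1 * Real.exp ((x ^ 2 - 1) / 2) ≤ Real.cosh x := by
      have e1 : Real.exp ((x ^ 2 - 1) / 2) =
          Real.exp ((-1) * 1 ^ 2 / 2) * Real.exp (x ^ 2 / 2) := by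
        rw [← Real.exp_add]; congr 1; ring
      have e2 : Real.exp ((-1) * x ^ 2 / 2) * Real.exp (x ^ 2 / 2) = 1 := by
        rw [← Real.exp_add, Real.exp_eq_one_iff]; ring
      have := mul_le_mul_of_nonneg_right h1 (Real.exp_pos (x ^ 2 / 2)).le
      rw [mul_assoc, mul_assoc, e2, mul_one] at this
      rwa [e1]
    have := mul_le_mul_of_nonneg_left (h2.trans h3) hc.le
    linarith

theorem isSharpRadiusF2_starExp :
    IsSharpRadiusF2 starExp
      ((2 * Real.exp 1 - 2) /
        (4 * Real.exp 1 + √(20 * Real.exp 1 ^ 2 - 8 * Real.exp 1 + 4))) := by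
  have hE : 1 < Real.exp 1 := by simp
  have hEi : Real.exp (-1) = 1 / Real.exp 1 := by rw [Real.exp_neg, one_div]
  have hE1 : Real.exp (-1) < 1 := by simp
  have hE0 : 0 < Real.exp (-1) := Real.exp_pos _
  have hRe : (2 * Real.exp 1 - 2) / (4 * Real.exp 1 + √(20 * Real.exp 1 ^ 2 - 8 * Real.exp 1 + 4)) =
      (1 - Real.exp (-1)) / (2 + √(4 + (1 - Real.exp (-1)) ^ 2)) := by
    have hEp := Real.exp_pos 1
    have e : 20 * Real.exp 1 ^ 2 - 8 * Real.exp 1 + 4 =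
        (2 * Real.exp 1) ^ 2 * (4 + (1 - Real.exp (-1)) ^ 2) := by
      rw [hEi]; field_simp; ring
    rw [e, Real.sqrt_mul (by positivity), Real.sqrt_sq (by positivity)]
    have hS := Real.sqrt_nonneg (4 + (1 - Real.exp (-1)) ^ 2)
    set S := √(4 + (1 - Real.exp (-1)) ^ 2)
    rw [hEi]
    field_simp
    ring
  rw [hRe]
  obtain ⟨hR0, hR1, hR⟩ := div_two_add_sqrt_spec (δ := 1 - Real.exp (-1)) (by linarith)
    (by linarith)
  set R := (1 - Real.exp (-1)) / (2 + √(4 + (1 - Real.exp (-1)) ^ 2))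
  have hR1' : R < 1 := by linarith
  have hl : leftF2 R = Real.exp (-1) := (leftF2_eq hR0 hR1' hR).trans (by ring)
  have hcosh : 3 / 2 ≤ Real.cosh 1 := by
    have h2 := Real.exp_one_gt_d9
    have h3 : (1 / 3 : ℝ) < Real.exp (-1) := by
      rw [hEi]; exact one_div_lt_one_div_of_lt (Real.exp_pos 1) (by linarith [Real.exp_one_lt_d9])
    rw [Real.cosh_eq]
    linarith
  have hsinh : Real.cosh 1 - Real.exp (-1) = Real.sinh 1 := by
    rw [← Real.cosh_sub_sinh]; ring
  have hre : ∀ u ∈ Metric.ball ((Real.cosh 1 : ℝ) : ℂ) (Real.cosh 1 - Real.exp (-1)),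
      0 < u.re := by
    intro u hu
    have := lt_of_mem_ball_left hu
    linarith
  have hne : ∀ u ∈ Metric.ball ((Real.cosh 1 : ℝ) : ℂ) (Real.cosh 1 - Real.exp (-1)),
      u ≠ 0 := by
    intro u hu h
    exact (hre u hu).ne' (by rw [h, zero_re])
  refine isSharpRadiusF2_of_rightInverse (ψ := Complex.log) (y := Real.exp (-1)) (m := 0)
    hR0 hR1' hl hE0 ?_ (ball_subset_of_left (b := Real.cosh 1) hR0 hR1' hl
      ((centerF2_le hR0 (by linarith)).trans (by linarith))) ?_ ?_ (by simp) ?_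
  · intro t ht0 ht z hz h
    have h1 := congrArg norm h
    rw [Complex.norm_exp, norm_real, Real.norm_eq_abs, abs_of_pos ht0] at h1
    rw [← h1, Real.exp_lt_exp] at ht
    linarith [neg_lt_of_abs_lt ((Complex.abs_re_le_norm z).trans_lt (mem_unitDisk.1 hz))]
  · exact fun u hu => (Complex.differentiableAt_log
      (mem_slitPlane_of_re_pos (hre u hu))).differentiableWithinAt
  · intro u hu
    have hr := hre u hu
    have hu0 := hne u hu
    have hn : 0 < ‖u‖ := norm_pos_iff.2 hu0
    rw [hsinh, mem_ball_ofReal (Real.sinh_nonneg_iff.2 zero_le_one)] at hu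
    rw [mem_unitDisk, norm_lt_iff zero_le_one, one_pow, log_re, log_im]
    refine sq_add_sq_lt_one_of_cosh_lt (abs_arg_le_pi_div_two_iff.2 hr.le) ?_
    have h1 := normSq_eq_re_im u
    have h2 := Real.cosh_sq 1
    rw [Complex.cos_arg hu0, Real.cosh_eq, Real.exp_neg, Real.exp_log hn]
    have h3 : ‖u‖ ^ 2 + 1 < 2 * Real.cosh 1 * u.re := by nlinarith
    have e : (‖u‖ + ‖u‖⁻¹) / 2 = (‖u‖ ^ 2 + 1) / (2 * ‖u‖) := by field_simp
    rw [e, ← mul_div_assoc, div_lt_div_iff₀ (by positivity) hn]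
    nlinarith
  · exact fun u hu => Complex.exp_log (hne u hu)

/-! ### The parabola. -/

lemma cosh_csqrt_eq {t v : ℂ} (h : v ^ 2 = t) : Complex.cosh (Complex.sqrt t) = Complex.cosh v := by
  rcases sq_eq_sq_iff_eq_or_eq_neg.1 ((csqrt_sq t).trans h.symm) with h | h
  · rw [h]
  · rw [h, Complex.cosh_neg]

lemma continuousAt_csqrt_zero : ContinuousAt Complex.sqrt 0 :=
  Complex.continuousAt_sqrt (Or.inl le_rfl)

/-- `cosh √t` is an entire function of `t`. -/
lemma differentiable_cosh_csqrt : Differentiable ℂ fun t => Complex.cosh (Complex.sqrt t) := by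
  rw [← differentiableOn_univ,
    ← differentiableOn_compl_singleton_and_continuousAt_iff (c := 0) Filter.univ_mem]
  refine ⟨fun t ht => DifferentiableAt.differentiableWithinAt ?_,
    Complex.continuous_cosh.continuousAt.comp continuousAt_csqrt_zero⟩
  have ht0 : t ≠ 0 := ht.2
  by_cases hs : t ∈ slitPlane
  · exact (Complex.differentiable_cosh _).comp t (Complex.differentiableAt_sqrt hs)
  · have hs' : -t ∈ slitPlane := by
      rw [mem_slitPlane_iff] at *
      push Not at hs
      left
      rw [neg_re]
      refine neg_pos.2 (hs.1.lt_of_ne fun h => ht0 (Complex.ext h hs.2))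
    have e : (fun t => Complex.cosh (Complex.sqrt t)) =
        fun t => Complex.cosh (I * Complex.sqrt (-t)) := by
      funext t
      exact cosh_csqrt_eq (by rw [mul_pow, csqrt_sq, I_sq]; ring)
    rw [e]
    have h1 : DifferentiableAt ℂ (fun t => I * Complex.sqrt (-t)) t :=
      (differentiableAt_csqrt_comp (by fun_prop) hs').const_mul I
    exact (Complex.differentiable_cosh _).comp t h1

lemma one_add_div_one_sub_re_pos {z : ℂ} (hz : z ∈ unitDisk) : 0 < ((1 + z) / (1 - z)).re := by
  have := re_pos_of_div_one_add (z := -z) (by rw [mem_unitDisk, norm_neg]; exact mem_unitDisk.1 hz)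
  rwa [sub_neg_eq_add, ← sub_eq_add_neg] at this

lemma abs_arg_lt_of_re_pos {z : ℂ} (hz : 0 < z.re) : |arg z| < Real.pi / 2 :=
  abs_arg_lt_pi_div_two_iff.2 (Or.inl hz)

lemma exp_re_pos {v : ℂ} (hv : |v.im| < Real.pi / 2) : 0 < (Complex.exp v).re := by
  rw [exp_re]
  exact mul_pos (Real.exp_pos _) (Real.cos_pos_of_mem_Ioo (abs_lt.1 hv))

lemma log_exp_of_abs_im_lt {v : ℂ} (hv : |v.im| < Real.pi / 2) :
    Complex.log (Complex.exp v) = v := by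
  have := abs_lt.1 hv
  have := Real.pi_pos
  exact Complex.log_exp (by linarith) (by linarith)

lemma sqrt_seventeen_sub_four_spec : 0 < √17 - 4 ∧ √17 - 4 ≤ 1 / 2 ∧
    4 * (√17 - 4) = 1 / 2 * (1 - (√17 - 4) ^ 2) := by
  have h : √17 ^ 2 = (17 : ℝ) := Real.sq_sqrt (by norm_num)
  have h1 : 4 < √17 := Real.lt_sqrt_of_sq_lt (by norm_num)
  have h2 : √17 < 4.5 := (Real.sqrt_lt' (by norm_num)).2 (by norm_num)
  exact ⟨by linarith, by linarith, by linear_combination (1 / 2) * h⟩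

/-- Writing `u = 1 + (2/π²)V²`, the inverse is `z = tanh²(V/2) = (cosh V - 1)/(cosh V + 1)`,
single-valued because it depends only on `V²`. It maps into the disk when `|Im V| < π/2`, which is
the parabolic region `|u-1| < Re u`; the disk `|u-3/2| < 1` lies inside. -/
theorem isSharpRadiusF2_starP : IsSharpRadiusF2 starP (√17 - 4) := by
  obtain ⟨hR0, hR1, hR⟩ := sqrt_seventeen_sub_four_spec
  have hR1' : √17 - 4 < 1 := by linarith
  have hl : leftF2 (√17 - 4) = 1 / 2 := (leftF2_eq hR0 hR1' hR).trans (by norm_num)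
  have hπ := Real.pi_pos
  have hπc : (Real.pi : ℂ) ≠ 0 := by exact_mod_cast hπ.ne'
  set U := Metric.ball ((3 / 2 : ℝ) : ℂ) (3 / 2 - 1 / 2) with hU
  set V : ℂ → ℂ := fun u => Complex.sqrt (((Real.pi ^ 2 / 2 : ℝ) : ℂ) * (u - 1)) with hV
  have hVim : ∀ u ∈ U, |(V u).im| < Real.pi / 2 := by
    intro u hu
    have h1 := lt_of_mem_ball_left hu
    rw [hU, mem_ball_ofReal (by norm_num)] at hu
    have h2 : ‖u - 1‖ < u.re := by
      rw [norm_lt_iff (by linarith), sub_re, sub_im, one_re, one_im]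
      nlinarith [sq_nonneg (u.re - 1 / 2)]
    have h3 : V u ^ 2 = ((Real.pi ^ 2 / 2 : ℝ) : ℂ) * (u - 1) := csqrt_sq _
    have h4 := congrArg norm h3
    have h5 := congrArg Complex.re h3
    rw [norm_pow, normSq_eq_re_im, norm_mul, norm_real, Real.norm_eq_abs,
      abs_of_pos (by positivity)] at h4
    rw [re_ofReal_mul, sq, mul_re, sub_re, one_re] at h5
    refine abs_lt_of_sq_lt_sq ?_ (by positivity)
    nlinarith [mul_lt_mul_of_pos_left h2 (by positivity : 0 < Real.pi ^ 2 / 2)]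
  have hEre : ∀ u ∈ U, 0 < (Complex.exp (V u)).re := fun u hu => exp_re_pos (hVim u hu)
  have hden : ∀ u ∈ U, Complex.exp (V u) + 1 ≠ 0 := fun u hu =>
    ne_zero_of_norm_lt (norm_sub_one_lt_norm_add_one (hEre u hu))
  have hC : ∀ u, Complex.cosh (V u) + 1 = (Complex.exp (V u) + 1) ^ 2 / (2 * Complex.exp (V u)) ∧
      Complex.cosh (V u) - 1 = (Complex.exp (V u) - 1) ^ 2 / (2 * Complex.exp (V u)) := by
    intro u
    have := Complex.exp_ne_zero (V u)
    constructor <;>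
    · rw [Complex.cosh, Complex.exp_neg]
      field_simp
      ring
  have hC0 : ∀ u ∈ U, Complex.cosh (V u) + 1 ≠ 0 := by
    intro u hu
    rw [(hC u).1]
    exact div_ne_zero (pow_ne_zero 2 (hden u hu)) (mul_ne_zero two_ne_zero (Complex.exp_ne_zero _))
  have hψ : ∀ u ∈ U, (Complex.cosh (V u) - 1) / (Complex.cosh (V u) + 1) =
      ((Complex.exp (V u) - 1) / (Complex.exp (V u) + 1)) ^ 2 := by
    intro u hu
    have h1 := Complex.exp_ne_zero (V u)
    have h2 := hden u hu
    rw [(hC u).1, (hC u).2]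
    field_simp
  refine isSharpRadiusF2_of_rightInverse
    (ψ := fun u => (Complex.cosh (V u) - 1) / (Complex.cosh (V u) + 1)) (y := 1 / 2) (m := 0)
    hR0 hR1' hl (by norm_num) ?_ (ball_subset_of_left (b := 3 / 2) hR0 hR1' hl
      ((centerF2_le hR0 hR1).trans (by norm_num))) ?_ ?_ (by simp [hV]) ?_
  · intro t _ ht z hz h
    have hs : Complex.sqrt z ∈ unitDisk := by
      have h1 := congrArg norm (csqrt_sq z)
      rw [norm_pow] at h1
      have h2 := mem_unitDisk.1 hz
      rw [mem_unitDisk]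
      nlinarith [norm_nonneg (Complex.sqrt z)]
    have harg := abs_arg_lt_of_re_pos (one_add_div_one_sub_re_pos hs)
    rw [← log_im] at harg
    set L := Complex.log ((1 + Complex.sqrt z) / (1 - Complex.sqrt z))
    have h1 : L ^ 2 = ((Real.pi ^ 2 * (t - 1) / 2 : ℝ) : ℂ) := by
      push_cast
      rw [← h]
      field_simp
      ring
    have h2 := congrArg Complex.re h1
    rw [sq, mul_re, ofReal_re] at h2
    -- `L²` is real and less than `-π²/4`, whereas `Re L² ≥ -(Im L)² > -π²/4`.
    have h3 := sq_lt_sq' (abs_lt.1 harg).1 (abs_lt.1 harg).2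
    nlinarith [mul_self_nonneg L.re, mul_lt_mul_of_pos_left ht (by positivity : 0 < Real.pi ^ 2)]
  · have hd : Differentiable ℂ fun u => Complex.cosh (V u) :=
      differentiable_cosh_csqrt.comp (by fun_prop)
    exact (hd.differentiableOn.sub_const 1).div (hd.differentiableOn.add_const 1) hC0
  · intro u hu
    rw [mem_unitDisk]
    simp only
    rw [hψ u hu, norm_pow]
    exact pow_lt_one₀ (norm_nonneg _)
      (norm_div_lt_one (norm_sub_one_lt_norm_add_one (hEre u hu))) two_ne_zero
  · intro u hu
    rw [hψ u hu]
    have h1 := Complex.exp_ne_zero (V u)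
    have h2 := hden u hu
    have h3 : V u ^ 2 = ((Real.pi ^ 2 / 2 : ℝ) : ℂ) * (u - 1) := csqrt_sq _
    have h4 := log_exp_of_abs_im_lt (hVim u hu)
    have h5 := log_exp_of_abs_im_lt (v := -V u) (by rw [neg_im, abs_neg]; exact hVim u hu)
    set s := (Complex.exp (V u) - 1) / (Complex.exp (V u) + 1) with hs
    have e1 : 1 + s = 2 * Complex.exp (V u) / (Complex.exp (V u) + 1) := by
      rw [hs]; field_simp; ring
    have e2 : 1 - s = 2 / (Complex.exp (V u) + 1) := by
      rw [hs]; field_simp; ring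
    -- The root of `s²` may be `-s`; this inverts the quotient and changes the sign of the
    -- logarithm, which the square removes.
    have hlog : Complex.log ((1 + Complex.sqrt (s ^ 2)) / (1 - Complex.sqrt (s ^ 2))) ^ 2 =
        V u ^ 2 := by
      rcases sq_eq_sq_iff_eq_or_eq_neg.1 (csqrt_sq (s ^ 2)) with h | h
      · rw [h, e1, e2, show 2 * Complex.exp (V u) / (Complex.exp (V u) + 1) /
          (2 / (Complex.exp (V u) + 1)) = Complex.exp (V u) by field_simp, h4]
      · rw [h, sub_neg_eq_add, ← sub_eq_add_neg, e1, e2, show 2 / (Complex.exp (V u) + 1) /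
          (2 * Complex.exp (V u) / (Complex.exp (V u) + 1)) = Complex.exp (-V u) by
            rw [Complex.exp_neg]; field_simp, h5, neg_sq]
    rw [hlog, h3]
    push_cast
    field_simp
    ring

/-! ### The sine function. -/

lemma sq_le_sinh_sq (y : ℝ) : y ^ 2 ≤ Real.sinh y ^ 2 := by
  rw [sq_le_sq, Real.abs_sinh]
  exact Real.self_le_sinh_iff.2 (abs_nonneg y)

/-- For `x ≥ 0`, multiply `sin 1 - sin x ≤ 1 - x` (the sine is 1-Lipschitz) by `sin 1 + sin x ≤ 1 +
x`. -/
lemma sq_sub_sin_sq_le {x : ℝ} (hx : |x| ≤ 1) :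
    x ^ 2 - Real.sin x ^ 2 ≤ 1 - Real.sin 1 ^ 2 := by
  have h1 := Real.abs_sin_sub_sin_le 1 |x|
  rw [abs_of_nonneg (sub_nonneg.2 hx)] at h1
  have h2 := (le_abs_self _).trans h1
  have h3 : 0 ≤ Real.sin |x| :=
    Real.sin_nonneg_of_nonneg_of_le_pi (abs_nonneg x) (by linarith [Real.pi_gt_three])
  have h4 := Real.sin_le (abs_nonneg x)
  have h5 := Real.sin_le zero_le_one
  have h6 : Real.sin x ^ 2 = Real.sin |x| ^ 2 := by
    rcases abs_choice x with h | h <;> rw [h]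
    rw [Real.sin_neg, neg_sq]
  have h7 : 0 ≤ Real.sin 1 := Real.sin_nonneg_of_nonneg_of_le_pi zero_le_one
    (by linarith [Real.pi_gt_three])
  rw [h6, ← sq_abs x]
  nlinarith [mul_le_mul h2 (add_le_add h5 h4) (by linarith) (sub_nonneg.2 hx)]

lemma sin_re_im (z : ℂ) :
    ‖Complex.sin z‖ ^ 2 = Real.sin z.re ^ 2 + Real.sinh z.im ^ 2 := by
  rw [normSq_eq_re_im, Complex.sin_eq]
  rw [← ofReal_sin, ← ofReal_cos, ← ofReal_cosh, ← ofReal_sinh]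
  simp only [add_re, add_im, mul_re, mul_im, ofReal_re, ofReal_im, I_re, I_im]
  have h1 := Real.cosh_sq z.im
  have h2 := Real.sin_sq_add_cos_sq z.re
  ring_nf
  rw [h1]
  linear_combination Real.sinh z.im ^ 2 * h2

/-- If `|z| ≥ 1` and `|x| ≤ 1`, then `|sin z|² = sin²x + sinh²y ≥ sin²x + 1 - x² ≥ sin²1`; for `1 <
|x| ≤ π/2` the term `sin²x` suffices. The bound on `Re z` selects the principal arcsine. -/
lemma norm_lt_one_of_norm_sin_lt {z : ℂ} (hz : |z.re| ≤ Real.pi / 2)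
    (h : ‖Complex.sin z‖ < Real.sin 1) : ‖z‖ < 1 := by
  have h1 := pow_lt_pow_left₀ h (norm_nonneg _) two_ne_zero
  rw [sin_re_im] at h1
  rw [norm_lt_iff zero_le_one, one_pow]
  by_contra! hge
  have h2 := sq_le_sinh_sq z.im
  rcases le_or_gt |z.re| 1 with hx | hx
  · have := sq_sub_sin_sq_le hx
    linarith
  · have h3 : Real.sin 1 ≤ Real.sin |z.re| :=
      Real.sin_le_sin_of_le_of_le_pi_div_two (by linarith [Real.pi_gt_three]) hz hx.le
    have h6 : Real.sin z.re ^ 2 = Real.sin |z.re| ^ 2 := by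
      rcases abs_choice z.re with h | h <;> rw [h]
      rw [Real.sin_neg, neg_sq]
    have h7 : 0 ≤ Real.sin 1 := Real.sin_nonneg_of_nonneg_of_le_pi zero_le_one
      (by linarith [Real.pi_gt_three])
    nlinarith [sq_nonneg (Real.sinh z.im)]

/-- The exponential of `i arcsin v`. -/
noncomputable def expArcsin (v : ℂ) : ℂ := I * v + Complex.sqrt (1 - v ^ 2)

lemma re_one_sub_sq_pos {v : ℂ} (hv : ‖v‖ < 1) : 0 < (1 - v ^ 2).re := by
  rw [norm_lt_iff zero_le_one] at hv
  rw [sq, sub_re, mul_re, one_re]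
  nlinarith [mul_self_nonneg v.im]

lemma expArcsin_re_pos {v : ℂ} (hv : ‖v‖ < 1) : 0 < (expArcsin v).re := by
  have h1 := csqrt_re_pos (mem_slitPlane_of_re_pos (re_one_sub_sq_pos hv))
  have h2 := congrArg Complex.re (csqrt_sq (1 - v ^ 2))
  rw [norm_lt_iff zero_le_one] at hv
  rw [sq, mul_re, sub_re, sq, mul_re, one_re] at h2
  rw [expArcsin, add_re, mul_re, I_re, I_im]
  have h3 : |v.im| < (Complex.sqrt (1 - v ^ 2)).re := by
    refine abs_lt_of_sq_lt_sq ?_ h1.le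
    rw [sq v]
    nlinarith [mul_self_nonneg (Complex.sqrt (1 - v * v)).im]
  linarith [le_abs_self v.im]

lemma sin_log_expArcsin {v : ℂ} (hv : ‖v‖ < 1) :
    Complex.sin (-I * Complex.log (expArcsin v)) = v := by
  have h0 : expArcsin v ≠ 0 := by
    intro h
    exact (expArcsin_re_pos hv).ne' (by rw [h, zero_re])
  have h1 : (expArcsin v)⁻¹ = -I * v + Complex.sqrt (1 - v ^ 2) := by
    refine inv_eq_of_mul_eq_one_right ?_
    rw [expArcsin]
    linear_combination csqrt_sq (1 - v ^ 2) - v ^ 2 * I_sq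
  have e1 : -(-I * Complex.log (expArcsin v)) * I = -Complex.log (expArcsin v) := by
    linear_combination Complex.log (expArcsin v) * I_sq
  have e2 : -I * Complex.log (expArcsin v) * I = Complex.log (expArcsin v) := by
    linear_combination -Complex.log (expArcsin v) * I_sq
  rw [Complex.sin, e1, e2, Complex.exp_neg, Complex.exp_log h0, h1, expArcsin]
  linear_combination -v * I_sq

lemma injOn_sin : Set.InjOn Complex.sin unitDisk := by
  intro z hz w hw h
  have hz1 := abs_lt.1 ((Complex.abs_re_le_norm z).trans_lt (mem_unitDisk.1 hz))
  have hw1 := abs_lt.1 ((Complex.abs_re_le_norm w).trans_lt (mem_unitDisk.1 hw))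
  have hπ := Real.pi_gt_three
  obtain ⟨k, hk | hk⟩ := Complex.sin_eq_sin_iff.1 h
  · have h1 := congrArg Complex.re hk
    rw [show 2 * (k : ℂ) * Real.pi + z = ((2 * k * Real.pi : ℝ) : ℂ) + z by push_cast; ring,
      add_re, ofReal_re] at h1
    have hk1 : (k : ℝ) < 1 := by nlinarith
    have hk2 : (-1 : ℝ) < k := by nlinarith
    have hk0 : k = 0 := by
      have a : k < 1 := by exact_mod_cast hk1
      have b : -1 < k := by exact_mod_cast hk2
      omega
    rw [hk, hk0]; simp
  · have h1 := congrArg Complex.re hk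
    rw [show (2 * (k : ℂ) + 1) * Real.pi - z = (((2 * k + 1) * Real.pi : ℝ) : ℂ) - z by
      push_cast; ring, sub_re, ofReal_re] at h1
    have hk1 : (2 * k + 1 : ℝ) < 1 := by nlinarith
    have hk2 : (-1 : ℝ) < 2 * k + 1 := by nlinarith
    have a : 2 * k + 1 < 1 := by exact_mod_cast hk1
    have b : -1 < 2 * k + 1 := by exact_mod_cast hk2
    omega

theorem radiusF2AtLeast_starSin :
    RadiusF2AtLeast starSin
      (Real.sin 1 / (2 + √(4 + Real.sin 1 * (2 + Real.sin 1)))) := by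
  have hs0 : 0 < Real.sin 1 := Real.sin_pos_of_pos_of_lt_pi one_pos (by linarith [Real.pi_gt_three])
  have hs1 : Real.sin 1 < 1 := by
    refine (Real.sin_lt one_pos)
  set s := Real.sin 1
  have hS : √(4 + s * (2 + s)) ^ 2 = 4 + s * (2 + s) := Real.sq_sqrt (by positivity)
  have hSn := Real.sqrt_nonneg (4 + s * (2 + s))
  set S := √(4 + s * (2 + s))
  set R := s / (2 + S) with hRdef
  have hR0 : 0 < R := by positivity
  have hR1 : R < 1 := by rw [hRdef, div_lt_one (by positivity)]; linarith
  -- The right endpoint of the value disk is `1 + sin 1`.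
  have hR : 4 * R + 2 * R ^ 2 = s * (1 - R ^ 2) := by
    rw [hRdef]
    field_simp
    linear_combination -hS
  have hlt : ∀ u ∈ Metric.ball (1 : ℂ) s, ‖u - 1‖ < 1 := by
    intro u hu
    rw [Metric.mem_ball, dist_eq_norm] at hu
    linarith
  refine radiusF2AtLeast_of_mem ?_ (mem_radiusSet_of_rightInverse
    (ψ := fun u => -I * Complex.log (expArcsin (u - 1)))
    (U := Metric.ball 1 s) hR0 hR1 (ball_subset_of_right hR0 hR1 hR) ?_ ?_
    (by simp [expArcsin]) ?_)
  · intro z hz w hw h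
    exact injOn_sin hz hw (add_left_cancel h)
  · intro u hu
    have h1 : DifferentiableAt ℂ (fun u : ℂ => Complex.sqrt (1 - (u - 1) ^ 2)) u :=
      differentiableAt_csqrt_comp (by fun_prop)
        (mem_slitPlane_of_re_pos (re_one_sub_sq_pos (hlt u hu)))
    have h2 : DifferentiableAt ℂ (fun u : ℂ => expArcsin (u - 1)) u :=
      DifferentiableAt.add (by fun_prop) h1
    exact ((h2.clog (mem_slitPlane_of_re_pos (expArcsin_re_pos (hlt u hu)))).const_mul
      (-I)).differentiableWithinAt
  · intro u hu
    rw [mem_unitDisk]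
    refine norm_lt_one_of_norm_sin_lt ?_ ?_
    · have : (-I * Complex.log (expArcsin (u - 1))).re = arg (expArcsin (u - 1)) := by
        simp [log_im]
      rw [this]
      exact (abs_arg_lt_of_re_pos (expArcsin_re_pos (hlt u hu))).le
    · rw [sin_log_expArcsin (hlt u hu)]
      rwa [Metric.mem_ball, dist_eq_norm] at hu
  · intro u hu
    rw [sin_log_expArcsin (hlt u hu)]
    ring

/-! ### Sectors: strongly starlike functions. -/

lemma injOn_strong {γ : ℝ} (h0 : 0 < γ) (h1 : γ ≤ 1) :
    Set.InjOn (fun z : ℂ => ((1 + z) / (1 - z)) ^ (γ : ℂ)) unitDisk := by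
  have hγ : (γ : ℂ) ≠ 0 := by exact_mod_cast h0.ne'
  have key : ∀ z ∈ unitDisk, (1 + z) / (1 - z) ≠ 0 ∧
      Complex.log (((1 + z) / (1 - z)) ^ (γ : ℂ)) = Complex.log ((1 + z) / (1 - z)) * γ := by
    intro z hz
    have hne : (1 + z) / (1 - z) ≠ 0 := div_ne_zero (one_add_ne_zero_of_mem hz)
      (one_sub_ne_zero_of_mem hz)
    have harg := abs_arg_lt_of_re_pos (one_add_div_one_sub_re_pos hz)
    refine ⟨hne, ?_⟩
    rw [cpow_def_of_ne_zero hne]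
    refine log_exp_of_abs_im_lt ?_
    rw [im_mul_ofReal, log_im, abs_mul, abs_of_pos h0]
    nlinarith [abs_nonneg (arg ((1 + z) / (1 - z)))]
  intro z hz w hw h
  have h2 := congrArg Complex.log h
  simp only at h2
  rw [(key z hz).2, (key w hw).2] at h2
  have h3 := congrArg Complex.exp (mul_right_cancel₀ hγ h2)
  rw [Complex.exp_log (key z hz).1, Complex.exp_log (key w hw).1,
    div_eq_div_iff (one_sub_ne_zero_of_mem hz) (one_sub_ne_zero_of_mem hw)] at h3
  linear_combination h3 / 2

/-- `R` solves `R² + 4R = sin θ` with `θ = πγ/2`, so the value disk has centre `a` and radius `a sin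
θ` and touches the sides of the sector `|arg u| < θ`. In it `|u|² + a²cos²θ < 2a Re u`, while the
left side is at least `2a|u|cos θ`. -/
theorem radiusF2AtLeast_starStrong {γ : ℝ} (h0 : 0 < γ) (h1 : γ ≤ 1) :
    RadiusF2AtLeast (starStrong γ)
      (Real.sin (Real.pi * γ / 2) / (2 + √(4 + Real.sin (Real.pi * γ / 2)))) := by
  have hπ := Real.pi_pos
  set θ := Real.pi * γ / 2 with hθ
  have hθ0 : 0 < θ := by positivity
  have hθ1 : θ ≤ Real.pi / 2 := by rw [hθ]; nlinarith
  have hs0 : 0 < Real.sin θ := Real.sin_pos_of_pos_of_lt_pi hθ0 (by linarith)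
  have hs1 : Real.sin θ ≤ 1 := Real.sin_le_one θ
  have hc0 : 0 ≤ Real.cos θ := Real.cos_nonneg_of_mem_Icc ⟨by linarith, hθ1⟩
  have hsc := Real.sin_sq_add_cos_sq θ
  have hS : √(4 + Real.sin θ) ^ 2 = 4 + Real.sin θ := Real.sq_sqrt (by positivity)
  have hSn := Real.sqrt_nonneg (4 + Real.sin θ)
  set S := √(4 + Real.sin θ)
  have hRS : Real.sin θ / (2 + S) = S - 2 := by
    rw [div_eq_iff (by positivity)]; linear_combination -hS
  have hR0 : 0 < Real.sin θ / (2 + S) := by positivity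
  have hR1 : Real.sin θ / (2 + S) < 1 := by rw [div_lt_one (by positivity)]; linarith
  have hR : (Real.sin θ / (2 + S)) ^ 2 + 4 * (Real.sin θ / (2 + S)) = Real.sin θ := by
    rw [hRS]; linear_combination hS
  set R := Real.sin θ / (2 + S)
  have ha : 1 ≤ centerF2 R := one_le_centerF2 hR0 hR1
  have hspread : spreadF2 R = centerF2 R * Real.sin θ := by
    rw [spreadF2, centerF2, hR]; ring
  set a := centerF2 R
  have hcone : ∀ u ∈ Metric.ball (a : ℂ) (spreadF2 R), u ≠ 0 ∧ ‖u‖ * Real.cos θ < u.re := by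
    intro u hu
    rw [hspread, mem_ball_ofReal (by positivity)] at hu
    have hn := normSq_eq_re_im u
    refine ⟨?_, ?_⟩
    · rintro rfl
      simp only [zero_re, zero_im] at hu
      nlinarith [mul_nonneg (sq_nonneg a) (sq_nonneg (Real.cos θ))]
    · have h3 : ‖u‖ ^ 2 + a ^ 2 * Real.cos θ ^ 2 < 2 * a * u.re := by nlinarith
      nlinarith [sq_nonneg (‖u‖ - a * Real.cos θ)]
  have harg : ∀ u ∈ Metric.ball (a : ℂ) (spreadF2 R), |arg u| < θ := by
    intro u hu
    obtain ⟨hu0, h⟩ := hcone u hu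
    by_contra! hge
    have h2 := Real.cos_le_cos_of_nonneg_of_le_pi hθ0.le (abs_arg_le_pi u) hge
    rw [Real.cos_abs] at h2
    have h3 := norm_mul_cos_arg u
    nlinarith [mul_le_mul_of_nonneg_left h2 (norm_nonneg u)]
  have him : ∀ u ∈ Metric.ball (a : ℂ) (spreadF2 R),
      |(Complex.log u / (γ : ℂ)).im| < Real.pi / 2 := by
    intro u hu
    rw [div_ofReal_im, log_im, abs_div, abs_of_pos h0, div_lt_iff₀ h0]
    have := harg u hu
    rw [hθ] at this
    linarith
  have hre : ∀ u ∈ Metric.ball (a : ℂ) (spreadF2 R), 0 < (Complex.exp (Complex.log u / γ)).re :=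
    fun u hu => exp_re_pos (him u hu)
  have hden : ∀ u ∈ Metric.ball (a : ℂ) (spreadF2 R), Complex.exp (Complex.log u / γ) + 1 ≠ 0 :=
    fun u hu => ne_zero_of_norm_lt (norm_sub_one_lt_norm_add_one (hre u hu))
  refine radiusF2AtLeast_of_mem (injOn_strong h0 h1) (mem_radiusSet_of_rightInverse
    (ψ := fun u => (Complex.exp (Complex.log u / γ) - 1) / (Complex.exp (Complex.log u / γ) + 1))
    hR0 hR1 subset_rfl ?_ ?_ (by simp) ?_)
  · intro u hu
    have hu' : u ∈ slitPlane := mem_slitPlane_of_re_pos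
      ((mul_nonneg (norm_nonneg _) hc0).trans_lt (hcone u hu).2)
    have h3 : DifferentiableAt ℂ (fun u => Complex.exp (Complex.log u / γ)) u :=
      ((Complex.differentiableAt_log hu').div_const _).cexp
    exact ((h3.sub_const 1).div (h3.add_const 1) (hden u hu)).differentiableWithinAt
  · exact fun u hu => mem_unitDisk.2 (norm_div_lt_one (norm_sub_one_lt_norm_add_one (hre u hu)))
  · intro u hu
    have h3 := hden u hu
    have hγ : (γ : ℂ) ≠ 0 := by exact_mod_cast h0.ne'
    have e : (1 + (Complex.exp (Complex.log u / γ) - 1) / (Complex.exp (Complex.log u / γ) + 1)) /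
        (1 - (Complex.exp (Complex.log u / γ) - 1) / (Complex.exp (Complex.log u / γ) + 1)) =
        Complex.exp (Complex.log u / γ) := by
      have e1 : 1 - (Complex.exp (Complex.log u / γ) - 1) / (Complex.exp (Complex.log u / γ) + 1) =
          2 / (Complex.exp (Complex.log u / γ) + 1) := by field_simp; ring
      rw [e1]
      field_simp
      ring
    rw [e, cpow_def_of_ne_zero (Complex.exp_ne_zero _), log_exp_of_abs_im_lt (him u hu),
      div_mul_cancel₀ _ hγ, Complex.exp_log (hcone u hu).1]

/-! ### The reverse lemniscate. -/

/-- A disk with real centre inside the right lobe of the lemniscate `|v² - 1| = 1`. -/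
lemma lemniscate_of_norm_sub_lt {d u c : ℝ} (hd : 0 < d) (hu : 0 < u) (hud : u ^ 2 = 1 - d ^ 2)
    (hc0 : 0 ≤ c) (hc : c ^ 2 = u - u ^ 2) {v : ℂ} (hv : ‖v - (d : ℂ)‖ < c) :
    ‖v ^ 2 - 1‖ < 1 ∧ 0 < v.re := by
  rw [norm_lt_iff hc0, sub_re, sub_im, ofReal_re, ofReal_im, sub_zero, hc] at hv
  have hu1 : u ≤ 1 := by nlinarith
  have h1 : v.re ^ 2 + v.im ^ 2 + 1 - u < 2 * d * v.re := by nlinarith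
  have h2 : 0 ≤ v.re ^ 2 + v.im ^ 2 + 1 - u := by nlinarith [sq_nonneg v.re, sq_nonneg v.im]
  have hx : 0 < v.re := by
    have : 0 < 2 * d * v.re := h2.trans_lt h1
    exact pos_of_mul_pos_right this (by linarith)
  refine ⟨?_, hx⟩
  have h3 := pow_lt_pow_left₀ h1 h2 two_ne_zero
  set n := v.re ^ 2 + v.im ^ 2 with hn
  -- The difference `(n+1-u)² - d²(n²+2n)` is the square of `un - (1-u)`. The resulting `n² + 2n <
  -- 4(Re v)²` is exactly `|v²-1| < 1`.
  have h4 : d ^ 2 * (n ^ 2 + 2 * n) < d ^ 2 * (4 * v.re ^ 2) := by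
    have : d ^ 2 * (n ^ 2 + 2 * n) ≤ (n + 1 - u) ^ 2 := by
      rw [show d ^ 2 = 1 - u ^ 2 by linarith]
      nlinarith [sq_nonneg (u * n - (1 - u))]
    nlinarith
  have h5 := lt_of_mul_lt_mul_left h4 (sq_nonneg d)
  rw [norm_lt_iff zero_le_one, sq v, sub_re, sub_im, mul_re, mul_im, one_re, one_im]
  have h6 : n ^ 2 = (v.re ^ 2 + v.im ^ 2) ^ 2 := by rw [hn]
  nlinarith

/-- Let `X` be the radicand. Division by `(1-r²)²` turns the equation into `c² = u - u²` with `c =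
spreadF2 r` and `u = √X/(1-r²)`; moreover `u² = 1 - d²` for `d = √2 - centerF2 r`, as the lemniscate
lemma requires. -/
lemma lhsRL_eq (r : ℝ) :
    lhsRL r = r ^ 2 * (r + 4) ^ 2 + (r ^ 2 + √2) * (2 - √2 - r ^ 2)
      - (1 - r ^ 2) * √((r ^ 2 + √2) * (2 - √2 - r ^ 2)) := by
  have h2 := sq_sqrt_two
  unfold lhsRL
  linear_combination (-(r ^ 2 - 1) ^ 2 + 1) * h2

lemma radicand_eq (q : ℝ) :
    (q + √2) * (2 - √2 - q) = (2 * √2 - 2) * (1 - q) - q ^ 2 := by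
  linear_combination -sq_sqrt_two

/-- Monotonicity on `[0, 1/10]` makes the root found by the intermediate value theorem the smallest
one. -/
lemma lhsRL_strictMono {s t : ℝ} (hs : 0 ≤ s) (hst : s < t) (ht : t ≤ 1 / 10) :
    lhsRL s < lhsRL t := by
  obtain ⟨h21, h22⟩ := sqrt_two_bounds
  rw [lhsRL_eq, lhsRL_eq, radicand_eq, radicand_eq]
  have hq : s ^ 2 < t ^ 2 := by nlinarith
  have hq2 : t ^ 2 ≤ 1 / 100 := by nlinarith
  have hq0 := sq_nonneg s
  have hmain : s ^ 2 * (s + 4) ^ 2 < t ^ 2 * (t + 4) ^ 2 := by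
    have : s * (s + 4) < t * (t + 4) := by nlinarith
    have := pow_lt_pow_left₀ this (by positivity) two_ne_zero
    nlinarith
  set p := s ^ 2
  set q := t ^ 2
  have hX : 0.81 ≤ (2 * √2 - 2) * (1 - q) - q ^ 2 := by nlinarith
  have hXX : (2 * √2 - 2) * (1 - p) - p ^ 2 =
      (2 * √2 - 2) * (1 - q) - q ^ 2 + (q - p) * (2 * √2 - 2 + q + p) := by ring
  have hXle : (2 * √2 - 2) * (1 - q) - q ^ 2 ≤ (2 * √2 - 2) * (1 - p) - p ^ 2 := by
    rw [hXX]; nlinarith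
  have hY1 : √((2 * √2 - 2) * (1 - q) - q ^ 2) ^ 2 = (2 * √2 - 2) * (1 - q) - q ^ 2 :=
    Real.sq_sqrt (by linarith)
  have hY2 : √((2 * √2 - 2) * (1 - p) - p ^ 2) ^ 2 = (2 * √2 - 2) * (1 - p) - p ^ 2 :=
    Real.sq_sqrt (by linarith)
  have hY3 : 0.9 ≤ √((2 * √2 - 2) * (1 - q) - q ^ 2) := Real.le_sqrt_of_sq_le (by norm_num; linarith)
  have hY4 := Real.sqrt_le_sqrt hXle
  set y := √((2 * √2 - 2) * (1 - q) - q ^ 2)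
  set x := √((2 * √2 - 2) * (1 - p) - p ^ 2)
  -- The change of `X - (1-r²)√X` is `(1-p)(x-y) + (q-p)(y - (2√2-2+q+p))`, nonnegative because `y ≥
  -- 0.9`.
  nlinarith [mul_nonneg (by linarith : 0 ≤ 1 - p) (sub_nonneg.2 hY4),
    mul_nonneg (sub_nonneg.2 hq.le) (by linarith : 0 ≤ y - (2 * √2 - 2 + q + p))]

lemma lhsRL_neg : lhsRL 0.06915 < 0 := by
  rw [lhsRL_eq, radicand_eq]
  have h1 : (1.4142135 : ℝ) < √2 := Real.lt_sqrt_of_sq_lt (by norm_num)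
  have h2 : √2 < 1.4142136 := (Real.sqrt_lt' (by norm_num)).2 (by norm_num)
  have hX : (0.82444 : ℝ) ≤ (2 * √2 - 2) * (1 - 0.06915 ^ 2) - (0.06915 ^ 2) ^ 2 := by
    norm_num; linarith
  have hXu : (2 * √2 - 2) * (1 - 0.06915 ^ 2) - (0.06915 ^ 2) ^ 2 ≤ (0.82446 : ℝ) := by
    norm_num; linarith
  have hY2 := Real.sq_sqrt (by linarith :
    (0 : ℝ) ≤ (2 * √2 - 2) * (1 - 0.06915 ^ 2) - (0.06915 ^ 2) ^ 2)
  have hY3 : (0.90798 : ℝ) ≤ √((2 * √2 - 2) * (1 - 0.06915 ^ 2) - (0.06915 ^ 2) ^ 2) :=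
    Real.le_sqrt_of_sq_le (by norm_num at hX ⊢; linarith)
  have hY4 : √((2 * √2 - 2) * (1 - 0.06915 ^ 2) - (0.06915 ^ 2) ^ 2) ≤ (0.908 : ℝ) :=
    Real.sqrt_le_iff.2 ⟨by norm_num, by norm_num at hXu ⊢; linarith⟩
  rw [← hY2]
  rw [Real.sqrt_sq (Real.sqrt_nonneg _)]
  set y := √((2 * √2 - 2) * (1 - 0.06915 ^ 2) - (0.06915 ^ 2) ^ 2)
  nlinarith

lemma lhsRL_pos : 0 < lhsRL 0.06925 := by
  rw [lhsRL_eq, radicand_eq]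
  have h1 : (1.4142135 : ℝ) < √2 := Real.lt_sqrt_of_sq_lt (by norm_num)
  have h2 : √2 < 1.4142136 := (Real.sqrt_lt' (by norm_num)).2 (by norm_num)
  have hX : (0.82442 : ℝ) ≤ (2 * √2 - 2) * (1 - 0.06925 ^ 2) - (0.06925 ^ 2) ^ 2 := by
    norm_num; linarith
  have hXu : (2 * √2 - 2) * (1 - 0.06925 ^ 2) - (0.06925 ^ 2) ^ 2 ≤ (0.82444 : ℝ) := by
    norm_num; linarith
  have hY2 := Real.sq_sqrt (by linarith :
    (0 : ℝ) ≤ (2 * √2 - 2) * (1 - 0.06925 ^ 2) - (0.06925 ^ 2) ^ 2)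
  have hY3 : (0.90797 : ℝ) ≤ √((2 * √2 - 2) * (1 - 0.06925 ^ 2) - (0.06925 ^ 2) ^ 2) :=
    Real.le_sqrt_of_sq_le (by norm_num at hX ⊢; linarith)
  have hY4 : √((2 * √2 - 2) * (1 - 0.06925 ^ 2) - (0.06925 ^ 2) ^ 2) ≤ (0.908 : ℝ) :=
    Real.sqrt_le_iff.2 ⟨by norm_num, by norm_num at hXu ⊢; linarith⟩
  rw [← hY2]
  rw [Real.sqrt_sq (Real.sqrt_nonneg _)]
  set y := √((2 * √2 - 2) * (1 - 0.06925 ^ 2) - (0.06925 ^ 2) ^ 2)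
  nlinarith

lemma continuous_lhsRL : Continuous lhsRL := by
  unfold lhsRL
  fun_prop

lemma exists_isLeast_lhsRL : ∃ ρ : ℝ,
    IsLeast {r : ℝ | r ∈ Set.Icc (0 : ℝ) 1 ∧ r ^ 2 ≤ 2 - √2 ∧ lhsRL r = 0} ρ ∧
      0.06915 < ρ ∧ ρ < 0.06925 := by
  obtain ⟨h21, h22⟩ := sqrt_two_bounds
  obtain ⟨ρ, ⟨h1, h2⟩, h0⟩ := intermediate_value_Icc (by norm_num : (0.06915 : ℝ) ≤ 0.06925)
    continuous_lhsRL.continuousOn ⟨lhsRL_neg.le, lhsRL_pos.le⟩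
  have h1' : 0.06915 < ρ := h1.lt_of_ne fun h => lhsRL_neg.ne (h ▸ h0)
  have h2' : ρ < 0.06925 := h2.lt_of_ne fun h => lhsRL_pos.ne' (h ▸ h0)
  refine ⟨ρ, ⟨⟨⟨by linarith, by linarith⟩, by nlinarith, h0⟩, ?_⟩, h1', h2'⟩
  rintro r ⟨⟨hr0, -⟩, -, hr⟩
  by_contra! hlt
  have := lhsRL_strictMono hr0 hlt (by linarith)
  linarith

lemma one_add_mul_ne_zero {c : ℝ} (hc0 : 0 ≤ c) (hc1 : c ≤ 1) {z : ℂ} (hz : z ∈ unitDisk) :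
    1 + (c : ℂ) * z ≠ 0 := by
  intro h
  have h1 : ‖(c : ℂ) * z‖ = 1 := by
    rw [show (c : ℂ) * z = -1 by linear_combination h]; simp
  rw [norm_mul, norm_real, Real.norm_eq_abs, abs_of_nonneg hc0] at h1
  have := mem_unitDisk.1 hz
  nlinarith [norm_nonneg z]

/-- The image of `φ` is the reflected lobe `|(√2-w)²-1| < 1`, `Re w < √2`; `ψ` is a Möbius map of
`(√2-w)²`. The substitution `v = √2-w` turns the value disk into one around `d`. -/
theorem radiusF2AtLeast_starRL {ρ : ℝ} (h0 : 0 < ρ) (h1 : ρ ≤ 1 / 10) (hρ : lhsRL ρ = 0) :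
    RadiusF2AtLeast starRL ρ := by
  obtain ⟨h21, h22⟩ := sqrt_two_bounds
  have h2 := sq_sqrt_two
  have hρ1 : ρ < 1 := by linarith
  have hc2 : ((√2 : ℝ) : ℂ) ^ 2 = 2 := by exact_mod_cast h2
  have hκ0 : ((√2 : ℝ) : ℂ) - 1 ≠ 0 := by exact_mod_cast (by linarith : √2 - 1 ≠ 0)
  have hp := one_sub_sq_pos h0.le hρ1
  have hp' : 0.99 ≤ 1 - ρ ^ 2 := by nlinarith
  set d := √2 - centerF2 ρ with hd
  have hap : centerF2 ρ * (1 - ρ ^ 2) = 1 := by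
    unfold centerF2; field_simp
  have hcp : spreadF2 ρ * (1 - ρ ^ 2) = ρ ^ 2 + 4 * ρ := by
    unfold spreadF2; field_simp
  have ha43 := centerF2_le h0 (by linarith)
  have hd0 : 0 < d := by rw [hd]; linarith
  have hc0 : 0 ≤ spreadF2 ρ := by unfold spreadF2; positivity
  rw [lhsRL_eq, radicand_eq] at hρ
  set X := (2 * √2 - 2) * (1 - ρ ^ 2) - (ρ ^ 2) ^ 2 with hX
  have hXpos : 0 < X := by rw [hX]; nlinarith
  have hY2 := Real.sq_sqrt hXpos.le
  have hY0 := Real.sqrt_pos.2 hXpos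
  set u := √X / (1 - ρ ^ 2) with hu
  have hu0 : 0 < u := div_pos hY0 hp
  have hup : u * (1 - ρ ^ 2) = √X := div_mul_cancel₀ _ hp.ne'
  have hp2 : (1 - ρ ^ 2) ^ 2 ≠ 0 := pow_ne_zero 2 hp.ne'
  have hdp : d * (1 - ρ ^ 2) = √2 * (1 - ρ ^ 2) - 1 := by rw [hd]; linear_combination -hap
  have hud : u ^ 2 = 1 - d ^ 2 := by
    apply mul_right_cancel₀ hp2
    have e1 : u ^ 2 * (1 - ρ ^ 2) ^ 2 = X := by rw [← mul_pow, hup, hY2]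
    have e2 : d ^ 2 * (1 - ρ ^ 2) ^ 2 = (√2 * (1 - ρ ^ 2) - 1) ^ 2 := by rw [← mul_pow, hdp]
    rw [e1, sub_mul, e2, hX]
    linear_combination (1 - ρ ^ 2) ^ 2 * h2
  have hcu : spreadF2 ρ ^ 2 = u - u ^ 2 := by
    apply mul_right_cancel₀ hp2
    have e1 : u ^ 2 * (1 - ρ ^ 2) ^ 2 = X := by rw [← mul_pow, hup, hY2]
    have e2 : spreadF2 ρ ^ 2 * (1 - ρ ^ 2) ^ 2 = (ρ ^ 2 + 4 * ρ) ^ 2 := by rw [← mul_pow, hcp]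
    rw [sub_mul, e1, e2]
    linear_combination hρ - (1 - ρ ^ 2) * hup
  have hlem : ∀ w ∈ Metric.ball (centerF2 ρ : ℂ) (spreadF2 ρ),
      ‖((√2 : ℝ) - w) ^ 2 - 1‖ < 1 ∧ 0 < ((√2 : ℝ) - w).re := by
    intro w hw
    refine lemniscate_of_norm_sub_lt hd0 hu0 hud hc0 hcu ?_
    rw [Metric.mem_ball, dist_eq_norm] at hw
    rwa [hd, ofReal_sub, sub_sub_sub_cancel_left, norm_sub_rev]
  have hlt : ∀ w ∈ Metric.ball (centerF2 ρ : ℂ) (spreadF2 ρ),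
      ‖((√2 - 1 : ℝ) : ℂ) - ((√2 + 1 : ℝ) : ℂ) * ((√2 : ℝ) - w) ^ 2‖ <
        ‖((√2 - 1 : ℝ) : ℂ) + 2 * ((√2 : ℝ) - w) ^ 2‖ := by
    intro w hw
    have h3 := (hlem w hw).1
    set V := (((√2 : ℝ) : ℂ) - w) ^ 2
    rw [norm_lt_iff zero_le_one, sub_re, sub_im, one_re, one_im] at h3
    rw [norm_lt_norm_iff]
    simp only [add_re, add_im, sub_re, sub_im, mul_re, mul_im, ofReal_re, ofReal_im, re_ofNat,
      im_ofNat]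
    have h4 : V.re ^ 2 + V.im ^ 2 < 2 * V.re := by nlinarith
    -- The difference of the squared norms is `(2√2-1)(2 Re V - |V|²)`.
    have h5 := mul_lt_mul_of_pos_left h4 (by linarith : 0 < 2 * √2 - 1)
    nlinarith
  refine radiusF2AtLeast_of_mem ?_ (mem_radiusSet_of_rightInverse
    (ψ := fun w => (((√2 - 1 : ℝ) : ℂ) - ((√2 + 1 : ℝ) : ℂ) * ((√2 : ℝ) - w) ^ 2) /
      (((√2 - 1 : ℝ) : ℂ) + 2 * ((√2 : ℝ) - w) ^ 2))
    h0 hρ1 subset_rfl ?_ ?_ ?_ ?_)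
  · intro z hz w hw h
    have h3 := csqrt_injective (mul_left_cancel₀ hκ0 (sub_right_injective h))
    have hne : ∀ z ∈ unitDisk, 1 + 2 * (((√2 : ℝ) : ℂ) - 1) * z ≠ 0 := by
      intro z hz
      have := one_add_mul_ne_zero (c := 2 * (√2 - 1)) (by linarith) (by linarith) hz
      push_cast at this
      exact this
    rw [div_eq_div_iff (hne z hz) (hne w hw)] at h3
    have h4 : 1 + 2 * (((√2 : ℝ) : ℂ) - 1) ≠ 0 := by
      exact_mod_cast (by linarith : 1 + 2 * (√2 - 1) ≠ 0)
    apply mul_left_cancel₀ h4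
    linear_combination -h3
  · exact DifferentiableOn.div (by fun_prop) (by fun_prop) fun w hw =>
      ne_zero_of_norm_lt (hlt w hw)
  · exact fun w hw => mem_unitDisk.2 (norm_div_lt_one (hlt w hw))
  · rw [div_eq_zero_iff]
    left
    push_cast
    linear_combination (1 - ((√2 : ℝ) : ℂ)) * hc2
  · intro w hw
    have hden := ne_zero_of_norm_lt (hlt w hw)
    have hre := (hlem w hw).2
    push_cast at hden ⊢
    set v := ((√2 : ℝ) : ℂ) - w with hv
    have hκ1 : 1 + 2 * (((√2 : ℝ) : ℂ) - 1) ≠ 0 := by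
      exact_mod_cast (by linarith : 1 + 2 * (√2 - 1) ≠ 0)
    have hvr : 0 < (v / (((√2 - 1 : ℝ) : ℂ))).re := by
      rw [div_ofReal_re]; exact div_pos hre (by linarith)
    push_cast at hvr
    set c := ((√2 : ℝ) : ℂ)
    have e : (1 - (c - 1 - (c + 1) * v ^ 2) / (c - 1 + 2 * v ^ 2)) /
        (1 + 2 * (c - 1) * ((c - 1 - (c + 1) * v ^ 2) / (c - 1 + 2 * v ^ 2))) =
        (v / (c - 1)) ^ 2 := by
      have e1 : 1 - (c - 1 - (c + 1) * v ^ 2) / (c - 1 + 2 * v ^ 2) =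
          (c + 3) * v ^ 2 / (c - 1 + 2 * v ^ 2) := by
        rw [eq_div_iff hden, sub_mul, div_mul_cancel₀ _ hden]; ring
      have e2 : 1 + 2 * (c - 1) * ((c - 1 - (c + 1) * v ^ 2) / (c - 1 + 2 * v ^ 2)) =
          (c - 1) * (1 + 2 * (c - 1)) / (c - 1 + 2 * v ^ 2) := by
        rw [eq_div_iff hden, add_mul, mul_assoc, div_mul_cancel₀ _ hden]
        linear_combination (-2 * v ^ 2) * hc2
      rw [e1, e2, div_div_div_cancel_right₀ hden, div_pow,
        div_eq_div_iff (mul_ne_zero hκ0 hκ1) (pow_ne_zero 2 hκ0)]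
      linear_combination (c - 1) * v ^ 2 * hc2
    rw [e, csqrt_sq_of_re_pos hvr, mul_div_cancel₀ _ hκ0, hv]
    ring

end RadiusStarlike

theorem theorem2 :
    extremalF2 ∈ classF2 ∧
    (∀ α : ℝ, 0 ≤ α → α < 1 →
      IsSharpRadiusF2 (starOrder α) ((1 - α) / (2 + √(4 + (α - 1) ^ 2)))) ∧
    RadiusF2AtLeast starBernoulli ((√5 - 2) / (1 + √2)) ∧
    IsSharpRadiusF2 starP (√17 - 4) ∧
    IsSharpRadiusF2 starExp
      ((2 * Real.exp 1 - 2) /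
        (4 * Real.exp 1 + √(20 * Real.exp 1 ^ 2 - 8 * Real.exp 1 + 4))) ∧
    IsSharpRadiusF2 starC (√10 - 3) ∧
    RadiusF2AtLeast starSin
      (Real.sin 1 / (2 + √(4 + Real.sin 1 * (2 + Real.sin 1)))) ∧
    IsSharpRadiusF2 starLune ((2 - √2) / (2 + √(10 - 4 * √2))) ∧
    IsSharpRadiusF2 starR ((3 - 2 * √2) / (2 + √(21 - 12 * √2))) ∧
    (∃ ρ : ℝ,
      IsLeast {r : ℝ | r ∈ Set.Icc (0 : ℝ) 1 ∧ r ^ 2 ≤ 2 - √2 ∧ lhsRL r = 0} ρ ∧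
      |ρ - 0.0692| < 0.00005 ∧
      RadiusF2AtLeast starRL ρ) ∧
    (∀ γ : ℝ, 0 < γ → γ ≤ 1 →
      RadiusF2AtLeast (starStrong γ)
        (Real.sin (Real.pi * γ / 2) / (2 + √(4 + Real.sin (Real.pi * γ / 2))))) := by
  refine ⟨extremalF2_mem, fun α h0 h1 => isSharpRadiusF2_starOrder h0 h1,
    radiusF2AtLeast_starBernoulli, isSharpRadiusF2_starP, isSharpRadiusF2_starExp,
    isSharpRadiusF2_starC, radiusF2AtLeast_starSin, isSharpRadiusF2_starLune,
    isSharpRadiusF2_starR, ?_, fun γ h0 h1 => radiusF2AtLeast_starStrong h0 h1⟩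
  obtain ⟨ρ, hρ, h1, h2⟩ := exists_isLeast_lhsRL
  refine ⟨ρ, hρ, ?_, radiusF2AtLeast_starRL (by linarith) (by linarith) hρ.1.2.2⟩
  rw [abs_lt]
  constructor <;> linarith
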